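/- **Definitions.** All graphs are without loops and multiple edges. A connected graph $K$, with path metric $d$ on its vertex set $V(K)$, is *hyperbolic* if there is $\delta>0$ such that for all finite geodesic paths $\alpha=\alpha(0)\alpha(1)\cdots\alpha(m)$ and $\beta=\beta(0)\beta(1)\cdots\beta(n)$ of vertices with $\alpha(0)=\beta(0)=z$, and all integers $k\ge 0$ with $k\le\langle x,y\rangle_z:=\frac12\big(d(x,z)+d(y,z)-d(x,y)\big)$, where $x=\alpha(m)$ and $y=\beta(n)$, one has $d(\alpha(k),\beta(k))<\delta$. The graph $K$ is *fine* if for every $n$ and every edge $e$ only finitely many circuits (closed paths without repeated vertices) of length at most $n$ contain $e$. A group $\Gamma$ is *hyperbolic relative to* a family $\mathcal G$ of subgroups (in the sense of Bowditch) if $\Gamma$ acts by graph automorphisms on a connected fine hyperbolic graph $K$ such that there are finitely many $\Gamma$-orbits of edges, every edge stabilizer is finite, and the infinite vertex stabilizers are exactly the infinite conjugates of members of $\mathcal G$. (Thus, if $\mathcal G$ is a conjugation-invariant family of infinite subgroups, then $\mathcal G$ is precisely the set of infinite vertex stabilizers.) For a discrete group $\Gamma$ let $\mathrm{Prob}(\Gamma)=\{\mu\in\ell_1(\Gamma):\mu\ge0,\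 \sum_{t\in\Gamma}\mu(t)=1\}$ with the topology of pointwise convergence and the action $(s\cdot\mu)(t)=\mu(s^{-1}t)$. An action of $\Gamma$ by homeomorphisms on a compact Hausdorff space $\Omega$ is *amenable* if for every finite $E\subset\Gamma$ and every $\varepsilon>0$ there is a continuous map $\Omega\ni\omega\mapsto\mu_\omega\in\mathrm{Prob}(\Gamma)$ with $\|s\cdot\mu_\omega-\mu_{s\omega}\|_1\le\varepsilon$ for all $s\in E$ and $\omega\in\Omega$. The group $\Gamma$ is *exact* if it acts amenably on some nonempty compact Hausdorff space. **Corollary (relatively hyperbolic groups).** Let $\Gamma$ be a finitely generated group which is hyperbolic relative to a family $\mathcal G$ of subgroups. If every group in $\mathcal G$ is exact, then $\Gamma$ is exact. -/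

import Mathlib

universe u

/-! ### Amenable actions and exact groups -/

/-- `Prob(Γ)`: the probability measures on the discrete set `Γ`, i.e. the nonnegative functions
`μ : Γ → ℝ` with `∑ μ(s) = 1`.  As a subset of `Γ → ℝ` it carries the topology of pointwise
convergence. -/
def ProbMeasures (Γ : Type u) : Set (Γ → ℝ) :=
  {μ | (∀ t, 0 ≤ μ t) ∧ HasSum μ 1}

/-- Amenability of an action of the discrete group `Γ` on a topological space `Ω`: for every finite
`E ⊆ Γ` and `ε > 0` there is a continuous map `μ : Ω → Prob(Γ)` with `‖s·μ_ω - μ_{sω}‖₁ ≤ ε` for all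
`s ∈ E` and `ω ∈ Ω`, where `(s·μ)(t) = μ(s⁻¹t)`.  (The series below always converges, as it is
dominated by the sum of two series with sum `1`.) -/
def IsAmenableAction (Γ Ω : Type u) [Group Γ] [TopologicalSpace Ω] [MulAction Γ Ω] : Prop :=
  ∀ (E : Finset Γ) (ε : ℝ), 0 < ε →
    ∃ μ : Ω → ProbMeasures Γ, Continuous μ ∧
      ∀ s ∈ E, ∀ ω : Ω,
        ∑' t : Γ, |(μ ω : Γ → ℝ) (s⁻¹ * t) - (μ (s • ω) : Γ → ℝ) t| ≤ ε

/-- A discrete group is exact if it acts amenably (by homeomorphisms) on some nonempty compact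
Hausdorff space. -/
def IsExactGroup (Γ : Type u) [Group Γ] : Prop :=
  ∃ (Ω : Type u) (_ : TopologicalSpace Ω) (_ : MulAction Γ Ω),
    Nonempty Ω ∧ CompactSpace Ω ∧ T2Space Ω ∧ ContinuousConstSMul Γ Ω ∧ IsAmenableAction Γ Ω

/-! ### Fine hyperbolic graphs -/

namespace SimpleGraph

variable {V : Type u} (K : SimpleGraph V)

/-- `α(0), α(1), …, α(n)` is a geodesic path of length `n` (values of `α` beyond `n` are ignored). -/
def IsGeodesicPath (α : ℕ → V) (n : ℕ) : Prop :=
  ∀ i ≤ n, ∀ j ≤ n, (K.dist (α i) (α j) : ℝ) = |(i : ℝ) - (j : ℝ)|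

/-- The Gromov product `⟨x, y⟩_z` for the path metric on the vertices. -/
noncomputable def gromovProduct (x y z : V) : ℝ :=
  ((K.dist x z : ℝ) + (K.dist y z : ℝ) - (K.dist x y : ℝ)) / 2

/-- A connected graph is hyperbolic if for some `δ > 0` all its geodesic triangles are `δ`-thin:
whenever `α`, `β` are finite geodesic paths issuing from the same vertex `z`, with endpoints
`α₊`, `β₊`, and `k ≤ ⟨α₊, β₊⟩_z`, then `d(α(k), β(k)) < δ`. -/
def IsHyperbolicGraph : Prop :=
  K.Connected ∧ ∃ δ : ℝ, 0 < δ ∧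
    ∀ (α β : ℕ → V) (m n : ℕ), K.IsGeodesicPath α m → K.IsGeodesicPath β n → α 0 = β 0 →
      ∀ k : ℕ, (k : ℝ) ≤ K.gromovProduct (α m) (β n) (α 0) → (K.dist (α k) (β k) : ℝ) < δ

/-- A graph is fine if for every `n` and every edge `e` only finitely many circuits (closed paths
without repeated vertices) of length at most `n` contain `e`.  `Walk.IsCycle` leaves out the
degenerate circuits `xyx`; only two of these contain a given edge. -/
def IsFineGraph : Prop :=
  ∀ (n : ℕ), ∀ e ∈ K.edgeSet,
    {c : (v : V) × K.Walk v v | c.2.IsCycle ∧ c.2.length ≤ n ∧ e ∈ c.2.edges}.Finite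

end SimpleGraph

/-! ### Relatively hyperbolic groups -/

/-- Relative hyperbolicity in the sense of Bowditch: `Γ` acts by automorphisms on a connected fine
hyperbolic graph `K`, with finitely many orbits of edges and with finite edge stabilizers, in such
a way that the infinite vertex stabilizers are exactly the infinite conjugates of members of `𝒢`.

If `𝒢` is a conjugation invariant family of infinite subgroups, the last condition says that `𝒢` is
precisely the set of infinite vertex stabilizers.  The present form also admits a family `𝒢` that
is only given up to conjugacy (by representatives), or that contains finite subgroups. -/
def IsHyperbolicRelativeTo (Γ : Type u) [Group Γ] (𝒢 : Set (Subgroup Γ)) : Prop :=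
  ∃ (V : Type u) (_ : MulAction Γ V) (K : SimpleGraph V),
    (∀ (g : Γ) (v w : V), K.Adj v w → K.Adj (g • v) (g • w)) ∧
    K.IsHyperbolicGraph ∧
    K.IsFineGraph ∧
    {O : Set (Sym2 V) | ∃ e ∈ K.edgeSet,
      O = Set.range (fun g : Γ => Sym2.map (fun v : V => g • v) e)}.Finite ∧
    (∀ e ∈ K.edgeSet, {g : Γ | Sym2.map (fun v : V => g • v) e = e}.Finite) ∧
    ∀ L : Subgroup Γ, Infinite L →
      ((∃ v : V, MulAction.stabilizer Γ v = L) ↔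
        ∃ H ∈ 𝒢, ∃ g : Γ, H.map (MulAut.conj g).toMonoidHom = L)

/-! Exactness of `Γ` amounts to `HasReiterMaps Γ Γ Γ`: restrict an amenable action to one orbit and
truncate the measures; conversely, extend the maps to the space of ultrafilters on `Γ`. By
`HasReiterMaps.of_stabilizers`, approximately equivariant maps from `Γ` to measures on the vertex
set `V` can be combined with such maps for the vertex stabilizers. A stabilizer is finite or
conjugate to a member of `𝒢`, so it remains to treat the action on `V`.

Fix an edge from `w` to `o`. For each product `g` of `k` generators, let travellers arrive in `g •
o` from `g • w`, follow geodesics towards `x` and stop after `N` steps. Moving `x` by a generator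
changes the set `A k x` of stops by at most one step in `k`. If these sets grow linearly in `k`, the
increments of `log #(A k x)` are small on average, and averaging the uniform measures gives the maps
(`HasReiterMaps.of_growth`). Growth is linear because of thinness: a stop off a reference geodesic
`β` from `x` to `o` lies on a circuit of bounded length through an edge of `β`, and fineness bounds
the number of vertices on such circuits (`card_le_of_subset_stopSet`).

The graph need not be locally finite, so the stops for all `x` together might form an infinite set.
Hence a traveller also stops before any turn that is not allowed. The allowed turns form an
invariant family, finite for each incoming edge, and contain every turn made off `β` within the
first `N` steps (`IsGeodesicPath.allowedTurn`). Premature stops therefore lie on `β`, and the linear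
bound does not depend on which turns are allowed. -/

open Filter Topology

/-! ### Exactness in terms of finitely supported measures. -/

/-- A finitely supported form of amenability of the action of `G` on `X`, relative to the `G`-set
`Y`: there are approximately equivariant maps from `X` to the probability measures on finite
subsets of `Y`. For `X = Y = G` this is a combinatorial form of exactness. -/
def HasReiterMaps (G X Y : Type*) [Group G] [MulAction G X] [MulAction G Y] : Prop :=
  ∀ (E : Finset G) (ε : ℝ), 0 < ε → ∃ (F : Finset Y) (μ : X → Y → ℝ),
    (∀ x t, 0 ≤ μ x t) ∧ (∀ x, ∀ t ∉ F, μ x t = 0) ∧ (∀ x, ∑ t ∈ F, μ x t = 1) ∧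
    ∀ s ∈ E, ∀ x, ∀ W : Finset Y, ∑ t ∈ W, |μ x (s⁻¹ • t) - μ (s • x) t| ≤ ε

theorem HasReiterMaps.comap {G X X' Y : Type*} [Group G] [MulAction G X] [MulAction G X']
    [MulAction G Y] (h : HasReiterMaps G X Y) (f : X' → X) (hf : ∀ (g : G) x, f (g • x) = g • f x) :
    HasReiterMaps G X' Y := by
  intro E ε hε
  obtain ⟨F, μ, h0, h1, h2, h3⟩ := h E ε hε
  refine ⟨F, fun x => μ (f x), fun x => h0 _, fun x => h1 _, fun x => h2 _, fun s hs x W => ?_⟩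
  simpa only [hf] using h3 s hs (f x) W

theorem HasReiterMaps.of_mulEquiv {G H : Type*} [Group G] [Group H] (e : G ≃* H)
    (h : HasReiterMaps G G G) : HasReiterMaps H H H := by
  classical
  intro E ε hε
  obtain ⟨F, μ, h0, h1, h2, h3⟩ := h (E.image e.symm) ε hε
  refine ⟨F.image e, fun x t => μ (e.symm x) (e.symm t), fun x t => h0 _ _, fun x t ht => h1 _ _ ?_,
    fun x => ?_, fun s hs x W => ?_⟩
  · intro h'
    exact ht (Finset.mem_image.2 ⟨_, h', by simp⟩)
  · rw [Finset.sum_image (fun a _ b _ hab => e.injective hab)]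
    simpa using h2 (e.symm x)
  · have := h3 (e.symm s) (Finset.mem_image_of_mem _ hs) (e.symm x) (W.image e.symm)
    rw [Finset.sum_image (fun a _ b _ hab => e.symm.injective hab)] at this
    simpa [smul_eq_mul] using this

theorem HasReiterMaps.of_finite (G : Type*) [Group G] [Finite G] : HasReiterMaps G G G := by
  classical
  have := Fintype.ofFinite G
  intro E ε hε
  refine ⟨Finset.univ, fun x t => if t = x then 1 else 0, fun x t => by positivity,
    fun x t ht => absurd (Finset.mem_univ t) ht, fun x => by simp, fun s _ x W => ?_⟩
  refine (Finset.sum_eq_zero fun t _ => ?_).trans_le hε.le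
  simp [inv_mul_eq_iff_eq_mul]

/-- The finite partial sums are continuous and increase to one, so compactness makes the convergence
uniform, as in Dini's theorem. -/
theorem ProbMeasures.exists_tight {Γ Ω : Type u} [TopologicalSpace Ω] [CompactSpace Ω]
    {μ : Ω → ProbMeasures Γ} (hμ : Continuous μ) {η : ℝ} (hη : 0 < η) :
    ∃ F : Finset Γ, ∀ ω, 1 - η < ∑ t ∈ F, (μ ω : Γ → ℝ) t := by
  classical
  have hc : ∀ t, Continuous fun ω => (μ ω : Γ → ℝ) t := fun t =>
    (continuous_apply t).comp (continuous_subtype_val.comp hμ)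
  obtain ⟨F, hF⟩ := isCompact_univ.elim_directed_cover
    (fun F : Finset Γ => {ω | 1 - η < ∑ t ∈ F, (μ ω : Γ → ℝ) t})
    (fun F => isOpen_lt continuous_const (continuous_finsetSum _ fun t _ => hc t))
    (fun ω _ => by
      have := (μ ω).2.2
      have h := (this.eventually (lt_mem_nhds (show 1 - η < 1 by linarith))).exists
      simpa using h)
    (directed_of_isDirected_le fun A B hAB ω (hω : _ < _) =>
      hω.trans_le (Finset.sum_le_sum_of_subset_of_nonneg hAB fun t _ _ => (μ ω).2.1 t))
  exact ⟨F, fun ω => hF (Set.mem_univ ω)⟩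

/-- Moving the mass outside of a finite set to a single point changes a probability measure little. -/
theorem sum_abs_truncate_le {Γ : Type*} [DecidableEq Γ] {p : Γ → ℝ} (h0 : ∀ t, 0 ≤ p t)
    (h1 : HasSum p 1) {F : Finset Γ} {η : ℝ} (hF : 1 - η ≤ ∑ t ∈ F, p t) (a : Γ) (W : Finset Γ) :
    ∑ t ∈ W, |((if t ∈ F then p t else 0) + if t = a then 1 - ∑ t ∈ F, p t else 0) - p t|
      ≤ 2 * η := by
  have hle : ∀ A : Finset Γ, ∑ t ∈ A, p t ≤ 1 := fun A => sum_le_hasSum A (fun t _ => h0 t) h1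
  calc _ ≤ ∑ t ∈ W, ((if t ∈ F then 0 else p t) + if t = a then 1 - ∑ t ∈ F, p t else 0) := by
        refine Finset.sum_le_sum fun t _ => ?_
        have := hle F
        have := h0 t
        rw [abs_le]
        split_ifs <;> constructor <;> linarith
    _ = ∑ t ∈ W \ F, p t + ∑ t ∈ W, (if t = a then 1 - ∑ t ∈ F, p t else 0) := by
        rw [Finset.sum_add_distrib, Finset.sdiff_eq_filter, Finset.sum_filter]
        simp only [ite_not]
    _ ≤ η + η := by
        refine add_le_add ?_ ?_
        · have := hle ((W \ F) ∪ F)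
          rw [Finset.sum_union Finset.sdiff_disjoint] at this
          linarith
        · rw [Finset.sum_ite_eq']
          have := hle F
          split_ifs <;> linarith
    _ = 2 * η := by ring

theorem IsExactGroup.hasReiterMaps {Γ : Type u} [Group Γ] (h : IsExactGroup Γ) :
    HasReiterMaps Γ Γ Γ := by
  classical
  obtain ⟨Ω, _, _, ⟨ω⟩, _, _, _, h⟩ := h
  intro E ε hε
  obtain ⟨μ, hc, hμ⟩ := h E (ε / 2) (half_pos hε)
  -- Truncation costs `2 * (ε / 8)` at each of `x` and `s * x`, and the action itself costs `ε / 2`.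
  obtain ⟨F, hF⟩ := ProbMeasures.exists_tight hc (show 0 < ε / 8 by linarith)
  set p : Γ → Γ → ℝ := fun x => μ (x • ω) with hp
  have p0 : ∀ x t, 0 ≤ p x t := fun x => (μ (x • ω)).2.1
  have p1 : ∀ x, HasSum (p x) 1 := fun x => (μ (x • ω)).2.2
  have pF : ∀ x, 1 - ε / 8 ≤ ∑ t ∈ F, p x t := fun x => (hF _).le
  set ν : Γ → Γ → ℝ := fun x t => (if t ∈ F then p x t else 0) +
    if t = 1 then 1 - ∑ t ∈ F, p x t else 0 with hν
  have hνp : ∀ x W, ∑ t ∈ W, |ν x t - p x t| ≤ 2 * (ε / 8) := fun x W =>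
    sum_abs_truncate_le (p0 x) (p1 x) (pF x) 1 W
  refine ⟨insert 1 F, ν, fun x t => ?_, fun x t ht => ?_, fun x => ?_, fun s hs x W => ?_⟩
  · have := sum_le_hasSum F (fun t _ => p0 x t) (p1 x)
    have := p0 x t
    simp only [hν]
    split_ifs <;> linarith
  · rw [Finset.mem_insert, not_or] at ht
    simp [hν, ht.1, ht.2]
  · simp only [hν, Finset.sum_add_distrib]
    rw [Finset.sum_ite_eq', if_pos (Finset.mem_insert_self _ _), Finset.sum_ite_mem,
      Finset.inter_eq_right.2 (Finset.subset_insert _ _)]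
    ring
  · have hsum : Summable fun t => |p x (s⁻¹ * t) - p (s * x) t| :=
      (((Equiv.mulLeft s⁻¹).summable_iff.2 (p1 x).summable).sub (p1 (s * x)).summable).abs
    have h1 : ∑ t ∈ W, |p x (s⁻¹ * t) - p (s * x) t| ≤ ε / 2 := by
      refine (hsum.sum_le_tsum W fun t _ => abs_nonneg _).trans ?_
      simpa only [hp, mul_smul] using hμ s hs (x • ω)
    have h2 : ∑ t ∈ W, |ν x (s⁻¹ * t) - p x (s⁻¹ * t)| ≤ 2 * (ε / 8) := by
      have := hνp x (W.image (s⁻¹ * ·))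
      rwa [Finset.sum_image fun a _ b _ hab => mul_left_cancel hab] at this
    have h3 := hνp (s * x) W
    calc _ ≤ ∑ t ∈ W, (|ν x (s⁻¹ * t) - p x (s⁻¹ * t)| + |p x (s⁻¹ * t) - p (s * x) t|
            + |ν (s * x) t - p (s * x) t|) := by
          refine Finset.sum_le_sum fun t _ => ?_
          rw [abs_sub_comm (ν (s * x) t), smul_eq_mul, smul_eq_mul]
          refine le_of_eq_of_le ?_ (abs_add_three _ _ _)
          congr 1
          ring
      _ ≤ ε := by
          rw [Finset.sum_add_distrib, Finset.sum_add_distrib]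
          linarith

/-- The action of a group on the ultrafilters on itself. -/
@[reducible]
def ultrafilterMulAction (Γ : Type*) [Group Γ] : MulAction Γ (Ultrafilter Γ) where
  smul g U := U.map (g * ·)
  one_smul U := by
    change U.map _ = U
    simp only [one_mul]
    exact Ultrafilter.map_id' U
  mul_smul g h U := by
    change U.map _ = (U.map _).map _
    rw [Ultrafilter.map_map]
    simp only [Function.comp_def, mul_assoc]

theorem HasReiterMaps.isExactGroup {Γ : Type u} [Group Γ] (h : HasReiterMaps Γ Γ Γ) :
    IsExactGroup Γ := by
  classical
  let := ultrafilterMulAction Γ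
  have hpure : ∀ g x : Γ, g • (pure x : Ultrafilter Γ) = pure (g * x) := fun g x =>
    Ultrafilter.map_pure _ _
  have hcs : ∀ g : Γ, Continuous fun U : Ultrafilter Γ => g • U := fun g => by
    refine ultrafilterBasis_is_basis.continuous_iff.2 ?_
    rintro _ ⟨s, rfl⟩
    exact ultrafilter_isOpen_basic ((g * ·) ⁻¹' s)
  refine ⟨Ultrafilter Γ, inferInstance, inferInstance, ⟨pure 1⟩, inferInstance, inferInstance,
    ⟨hcs⟩, fun E ε hε => ?_⟩
  obtain ⟨F, μ, h0, h1, h2, h3⟩ := h E ε hε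
  have hle : ∀ x t, μ x t ≤ 1 := fun x t => by
    by_cases ht : t ∈ F
    · exact (Finset.single_le_sum (fun t _ => h0 x t) ht).trans_eq (h2 x)
    · rw [h1 x t ht]; exact zero_le_one
  -- With values in a compact space each coordinate extends continuously to all ultrafilters. As the
  -- supports lie in one finite set, every condition involves finitely many coordinates and passes
  -- from the dense principal ultrafilters to the rest.
  let m : Γ → Γ → Set.Icc (0 : ℝ) 1 := fun t x => ⟨μ x t, h0 x t, hle x t⟩
  let ν : Ultrafilter Γ → Γ → ℝ := fun ω t =>
    ((Ultrafilter.extend (m t) ω : Set.Icc (0 : ℝ) 1) : ℝ)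
  have hνc : ∀ t, Continuous fun ω => ν ω t := fun t => by
    have : Continuous (Ultrafilter.extend (m t)) := continuous_ultrafilter_extend (m t)
    exact continuous_subtype_val.comp this
  have hνp : ∀ x t, ν (pure x) t = μ x t := fun x t => by
    simp only [ν, m, ultrafilter_extend_pure]
  have hν1 : ∀ ω, ∀ t ∉ F, ν ω t = 0 := fun ω t ht =>
    denseRange_pure.induction_on ω (isClosed_eq (hνc t) continuous_const)
      fun x => (hνp x t).trans (h1 x t ht)
  have hν2 : ∀ ω, ∑ t ∈ F, ν ω t = 1 := fun ω =>
    denseRange_pure.induction_on ω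
      (isClosed_eq (continuous_finsetSum _ fun t _ => hνc t) continuous_const)
      fun x => by simp only [hνp, h2]
  refine ⟨fun ω => ⟨ν ω, fun t => (Ultrafilter.extend (m t) ω).2.1, ?_⟩, ?_, fun s hs ω => ?_⟩
  · rw [← hν2 ω]
    exact hasSum_sum_of_ne_finset_zero (hν1 ω)
  · exact Continuous.subtype_mk (continuous_pi hνc) _
  · change ∑' t, |ν ω (s⁻¹ * t) - ν (s • ω) t| ≤ ε
    rw [tsum_eq_sum (s := F ∪ F.image (s * ·))]
    · refine denseRange_pure.induction_on ω (isClosed_le (continuous_finsetSum _ fun t _ =>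
        ((hνc _).sub ((hνc t).comp (hcs s))).abs) continuous_const) fun x => ?_
      simp only [hνp, hpure]
      exact h3 s hs x _
    · intro t ht
      rw [Finset.mem_union, not_or] at ht
      rw [hν1 _ t ht.1, hν1 ω, sub_zero, abs_zero]
      intro h'
      exact ht.2 (Finset.mem_image.2 ⟨_, h', by simp⟩)

theorem sum_le_one_of_support {Y : Type*} {p : Y → ℝ} {F : Finset Y} (h0 : ∀ t, 0 ≤ p t)
    (hF : ∀ t ∉ F, p t = 0) (h1 : ∑ t ∈ F, p t = 1) (W : Finset Y) : ∑ t ∈ W, p t ≤ 1 := by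
  have : HasSum p 1 := h1 ▸ hasSum_sum_of_ne_finset_zero hF
  exact sum_le_hasSum W (fun t _ => h0 t) this

/-! ### Induction from vertex stabilizers. -/

/-- A subgroup `H` of `Γ` acts on `Γ` by left multiplication, and `Γ` maps equivariantly to `H`. -/
theorem HasReiterMaps.of_subgroup {Γ : Type*} [Group Γ] {H : Subgroup Γ}
    (h : HasReiterMaps H H H) : HasReiterMaps H Γ H := by
  -- `c x` represents the coset `H x`, so `x ↦ x * (c x)⁻¹` is the equivariant map to `H`.
  let c : Γ → Γ := fun x => (Quotient.mk (QuotientGroup.rightRel H) x).out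
  have hc : ∀ x, x * (c x)⁻¹ ∈ H := fun x => by
    have := Quotient.mk_out (s := QuotientGroup.rightRel H) x
    exact QuotientGroup.rightRel_apply.1 this
  have hmul : ∀ (g : H) x, c (g * x) = c x := fun g x => by
    have : Quotient.mk (QuotientGroup.rightRel H) (g * x) = Quotient.mk _ x := by
      refine Quotient.sound (QuotientGroup.rightRel_apply.2 ?_)
      simp
    simp only [c, this]
  refine h.comap (fun x => ⟨x * (c x)⁻¹, hc x⟩) fun g x => Subtype.ext ?_
  change (g * x) * (c (g * x))⁻¹ = g * (x * (c x)⁻¹)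
  rw [hmul, mul_assoc]

theorem HasReiterMaps.exists_extend {Γ : Type*} [Group Γ] {H : Subgroup Γ}
    (h : HasReiterMaps H H H) (E : Finset Γ) {ε : ℝ} (hε : 0 < ε) :
    ∃ (F : Finset Γ) (ν : Γ → Γ → ℝ), (∀ x t, 0 ≤ ν x t) ∧ (∀ x, ∀ t ∉ F, ν x t = 0) ∧
      (∀ x, ∑ t ∈ F, ν x t = 1) ∧ ∀ s ∈ E, s ∈ H → ∀ x, ∀ W : Finset Γ,
        ∑ t ∈ W, |ν x (s⁻¹ * t) - ν (s * x) t| ≤ ε := by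
  classical
  obtain ⟨F, ν, h0, h1, h2, h3⟩ := h.of_subgroup (E.subtype (· ∈ H)) ε hε
  refine ⟨F.map (Function.Embedding.subtype _),
    fun x t => if ht : t ∈ H then ν x ⟨t, ht⟩ else 0, fun x t => ?_, fun x t ht => ?_, fun x => ?_,
    fun s hs hsH x W => ?_⟩
  · dsimp only
    split_ifs
    exacts [h0 _ _, le_rfl]
  · dsimp only
    split_ifs with htH
    · exact h1 _ _ fun h' => ht (Finset.mem_map.2 ⟨_, h', rfl⟩)
    · rfl
  · rw [Finset.sum_map, ← h2 x]
    refine Finset.sum_congr rfl fun t _ => ?_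
    simp
  · have h4 := h3 ⟨s, hsH⟩ (by simpa using hs) x (W.subtype (· ∈ H))
    refine le_of_eq_of_le ?_ h4
    have hmem : ∀ t, s⁻¹ * t ∈ H ↔ t ∈ H := fun t => H.mul_mem_cancel_left (H.inv_mem hsH)
    rw [← Finset.sum_filter_of_ne (p := (· ∈ H)), ← Finset.sum_subtype_eq_sum_filter]
    · refine Finset.sum_congr rfl fun t _ => ?_
      dsimp only
      rw [dif_pos ((hmem t).2 t.2), dif_pos t.2]
      rfl
    · intro t _ ht
      by_contra htH
      dsimp only at ht
      rw [dif_neg htH, dif_neg (mt (hmem t).1 htH)] at ht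
      simp at ht

/-- The measure at `x` is a mixture with weights `f x v` of measures `N v x`, obtained by
transporting the maps of the stabilizer of an orbit representative to `v`. -/
theorem HasReiterMaps.of_stabilizers {Γ V : Type*} [Group Γ] [MulAction Γ V]
    (h : HasReiterMaps Γ Γ V)
    (hst : ∀ v : V, HasReiterMaps (MulAction.stabilizer Γ v) (MulAction.stabilizer Γ v)
      (MulAction.stabilizer Γ v)) : HasReiterMaps Γ Γ Γ := by
  classical
  intro E ε hε
  obtain ⟨F, f, f0, f1, f2, f3⟩ := h E (ε / 2) (half_pos hε)
  let r : V → V := fun v => (Quotient.mk (MulAction.orbitRel Γ V) v).out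
  have hr : ∀ (g : Γ) v, r (g • v) = r v := fun g v => by
    have : Quotient.mk (MulAction.orbitRel Γ V) (g • v) = Quotient.mk (MulAction.orbitRel Γ V) v :=
      Quotient.sound ⟨g, rfl⟩
    simp only [r, this]
  have hσ : ∀ v, ∃ g : Γ, g • r v = v := fun v => by
    exact Setoid.symm' (MulAction.orbitRel Γ V) (Quotient.mk_out (s := MulAction.orbitRel Γ V) v)
  choose σ hσ using hσ
  -- This cocycle measures the failure of `σ` to be equivariant. Its values for `s ∈ E` and `v ∈ F`
  -- are finitely many, so the `ν v` can be chosen almost invariant under all of those that matter.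
  let k : Γ → V → Γ := fun s v => (σ (s • v))⁻¹ * s * σ v
  have hk : ∀ s v, k s v ∈ MulAction.stabilizer Γ (r v) := fun s v => by
    rw [MulAction.mem_stabilizer_iff]
    simp only [k, mul_smul, hσ]
    rw [inv_smul_eq_iff, ← hr s v, hσ]
  choose S ν ν0 ν1 ν2 ν3 using fun v =>
    (hst v).exists_extend ((E ×ˢ F).image fun a => k a.1 a.2) (half_pos hε)
  let N : V → Γ → Γ → ℝ := fun v x t => ν (r v) ((σ v)⁻¹ * x) ((σ v)⁻¹ * t)
  have N0 : ∀ v x t, 0 ≤ N v x t := fun v x t => ν0 _ _ _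
  let S' : V → Finset Γ := fun v => (S (r v)).image (σ v * ·)
  have N1 : ∀ v x, ∀ t ∉ S' v, N v x t = 0 := fun v x t ht =>
    ν1 _ _ _ fun h' => ht (Finset.mem_image.2 ⟨_, h', by simp⟩)
  have N2 : ∀ v x, ∑ t ∈ S' v, N v x t = 1 := fun v x => by
    simp only [S', N]
    rw [Finset.sum_image fun a _ b _ hab => mul_left_cancel hab]
    simp only [inv_mul_cancel_left, ν2]
  have N3 : ∀ s ∈ E, ∀ v ∈ F, ∀ x, ∀ W : Finset Γ,
      ∑ t ∈ W, |N v x (s⁻¹ * t) - N (s • v) (s * x) t| ≤ ε / 2 := fun s hs v hv x W => by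
    have := ν3 (r v) (k s v) (Finset.mem_image.2 ⟨(s, v), Finset.mk_mem_product hs hv, rfl⟩)
      (hk s v) ((σ v)⁻¹ * x) (W.image ((σ (s • v))⁻¹ * ·))
    rw [Finset.sum_image fun a _ b _ hab => mul_left_cancel hab] at this
    simpa only [N, hr, k, mul_inv_rev, inv_inv, mul_assoc, mul_inv_cancel_left] using this
  refine ⟨F.biUnion S', fun x t => ∑ v ∈ F, f x v * N v x t,
    fun x t => Finset.sum_nonneg fun v _ => mul_nonneg (f0 _ _) (N0 _ _ _), fun x t ht => ?_,
    fun x => ?_, fun s hs x W => ?_⟩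
  · refine Finset.sum_eq_zero fun v hv => ?_
    rw [N1 v x t fun h' => ht (Finset.mem_biUnion.2 ⟨v, hv, h'⟩), mul_zero]
  · rw [Finset.sum_comm, ← f2 x]
    refine Finset.sum_congr rfl fun v hv => ?_
    rw [← Finset.mul_sum, ← Finset.sum_subset (Finset.subset_biUnion_of_mem S' hv)
      (fun t _ ht => N1 v x t ht), N2, mul_one]
  · simp only [smul_eq_mul]
    have hA : ∀ t, ∑ v ∈ F, f x v * N (s • v) (s * x) t =
        ∑ w ∈ F ∪ F.image (s • ·), f x (s⁻¹ • w) * N w (s * x) t := fun t => by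
      rw [← Finset.sum_subset Finset.subset_union_right, Finset.sum_image fun a _ b _ hab =>
        smul_left_cancel s hab]
      · simp only [inv_smul_smul]
      · intro w _ hw
        rw [f1 x, zero_mul]
        exact fun h' => hw (Finset.mem_image.2 ⟨_, h', smul_inv_smul _ _⟩)
    have hB : ∀ t, ∑ v ∈ F, f (s * x) v * N v (s * x) t =
        ∑ w ∈ F ∪ F.image (s • ·), f (s * x) w * N w (s * x) t := fun t => by
      refine Finset.sum_subset Finset.subset_union_left fun w _ hw => ?_
      rw [f1 _ w hw, zero_mul]
    -- The first sum is the error of the measures `N`, the second that of the weights `f`.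
    have hpt : ∀ t, |∑ v ∈ F, f x v * N v x (s⁻¹ * t) - ∑ v ∈ F, f (s * x) v * N v (s * x) t| ≤
        ∑ v ∈ F, f x v * |N v x (s⁻¹ * t) - N (s • v) (s * x) t| +
        ∑ w ∈ F ∪ F.image (s • ·), |f x (s⁻¹ • w) - f (s * x) w| * N w (s * x) t := fun t => by
      have e1 : ∑ v ∈ F, f x v * N v x (s⁻¹ * t) - ∑ v ∈ F, f (s * x) v * N v (s * x) t =
          ∑ v ∈ F, f x v * (N v x (s⁻¹ * t) - N (s • v) (s * x) t) +
          ∑ w ∈ F ∪ F.image (s • ·), (f x (s⁻¹ • w) - f (s * x) w) * N w (s * x) t := by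
        simp only [mul_sub, sub_mul, Finset.sum_sub_distrib]
        rw [← hA, ← hB]
        ring
      rw [e1]
      refine (abs_add_le _ _).trans (add_le_add ?_ ?_)
      · refine (Finset.abs_sum_le_sum_abs _ _).trans_eq (Finset.sum_congr rfl fun v _ => ?_)
        rw [abs_mul, abs_of_nonneg (f0 _ _)]
      · refine (Finset.abs_sum_le_sum_abs _ _).trans_eq (Finset.sum_congr rfl fun v _ => ?_)
        rw [abs_mul, abs_of_nonneg (N0 _ _ _)]
    refine (Finset.sum_le_sum fun t _ => hpt t).trans ?_
    rw [Finset.sum_add_distrib, Finset.sum_comm, Finset.sum_comm (s := W)]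
    simp only [← Finset.mul_sum]
    have b1 : ∑ v ∈ F, f x v * ∑ t ∈ W, |N v x (s⁻¹ * t) - N (s • v) (s * x) t| ≤ ε / 2 := by
      calc _ ≤ ∑ v ∈ F, f x v * (ε / 2) := Finset.sum_le_sum fun v hv =>
            mul_le_mul_of_nonneg_left (N3 s hs v hv x W) (f0 _ _)
        _ = ε / 2 := by rw [← Finset.sum_mul, f2, one_mul]
    have b2 : ∑ w ∈ F ∪ F.image (s • ·), |f x (s⁻¹ • w) - f (s * x) w| * ∑ t ∈ W, N w (s * x) t
        ≤ ε / 2 := by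
      refine le_trans (Finset.sum_le_sum fun w _ => ?_) (f3 s hs x (F ∪ F.image (s • ·)))
      refine (mul_le_mul_of_nonneg_left ?_ (abs_nonneg _)).trans_eq (mul_one _)
      exact sum_le_one_of_support (N0 w _) (N1 w _) (N2 w _) W
    linarith

/-! ### Averaging over sets of linear growth. -/

/-- The uniform probability measures on two finite sets `A` and `B` with `C ⊆ A ∩ B` and
`A ∪ B ⊆ D` are close if the ratio of `#D` and `#C` is close to one. -/
theorem sum_abs_uniform_sub_uniform_le {Y : Type*} [DecidableEq Y] {A B C D : Finset Y}
    (hCA : C ⊆ A) (hCB : C ⊆ B) (hAD : A ⊆ D) (hBD : B ⊆ D) (hC : C.Nonempty) (W : Finset Y) :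
    ∑ t ∈ W, |(if t ∈ A then (A.card : ℝ)⁻¹ else 0) - (if t ∈ B then (B.card : ℝ)⁻¹ else 0)| ≤
      2 * (Real.log D.card - Real.log C.card) := by
  have hc : (0 : ℝ) < C.card := by exact_mod_cast hC.card_pos
  have hcA : (C.card : ℝ) ≤ A.card := by exact_mod_cast Finset.card_le_card hCA
  have hcB : (C.card : ℝ) ≤ B.card := by exact_mod_cast Finset.card_le_card hCB
  have hAd : (A.card : ℝ) ≤ D.card := by exact_mod_cast Finset.card_le_card hAD
  have hBd : (B.card : ℝ) ≤ D.card := by exact_mod_cast Finset.card_le_card hBD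
  have hA : 0 < (A.card : ℝ) := by linarith
  have hB : 0 < (B.card : ℝ) := by linarith
  have hD : 0 < (D.card : ℝ) := by linarith
  have hAi : (D.card : ℝ)⁻¹ ≤ (A.card : ℝ)⁻¹ := inv_anti₀ hA hAd
  have hBi : (D.card : ℝ)⁻¹ ≤ (B.card : ℝ)⁻¹ := inv_anti₀ hB hBd
  have hA0 := inv_pos.2 hA
  have hB0 := inv_pos.2 hB
  have hsum : ∀ S : Finset Y, S ⊆ D → ∀ c : ℝ, ∑ t ∈ W ∪ D, (if t ∈ S then c else 0) = S.card * c :=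
    fun S hS c => by
      rw [Finset.sum_ite_mem, Finset.inter_eq_right.2 (hS.trans Finset.subset_union_right),
        Finset.sum_const, nsmul_eq_mul]
  calc _ ≤ ∑ t ∈ W ∪ D,
        |(if t ∈ A then (A.card : ℝ)⁻¹ else 0) - (if t ∈ B then (B.card : ℝ)⁻¹ else 0)| :=
        Finset.sum_le_sum_of_subset_of_nonneg Finset.subset_union_left fun _ _ _ => abs_nonneg _
    _ ≤ ∑ t ∈ W ∪ D, ((if t ∈ A then (A.card : ℝ)⁻¹ else 0) +
          (if t ∈ B then (B.card : ℝ)⁻¹ else 0) - 2 * (if t ∈ C then (D.card : ℝ)⁻¹ else 0)) := by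
        refine Finset.sum_le_sum fun t _ => ?_
        rw [abs_le]
        by_cases h : t ∈ C
        · rw [if_pos h, if_pos (hCA h), if_pos (hCB h)]
          constructor <;> linarith
        · rw [if_neg h]
          split_ifs <;> constructor <;> linarith
    _ = 2 * (1 - (D.card / C.card : ℝ)⁻¹) := by
        rw [Finset.sum_sub_distrib, Finset.sum_add_distrib, ← Finset.mul_sum, hsum A hAD,
          hsum B hBD, hsum C (hCA.trans hAD), mul_inv_cancel₀ hA.ne', mul_inv_cancel₀ hB.ne', inv_div]
        ring
    _ ≤ _ := by
        rw [← Real.log_div hD.ne' hc.ne']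
        have := Real.one_sub_inv_le_log_of_pos (div_pos hD hc)
        linarith

/-- Approximately equivariant maps can be obtained by averaging over an increasing sequence of
approximately equivariant finite sets of linear growth. -/
theorem HasReiterMaps.of_growth {G X Y : Type*} [Group G] [MulAction G X] [MulAction G Y]
    [DecidableEq Y]
    (h : ∀ E : Finset G, ∃ c : ℕ, ∀ n : ℕ, ∃ (F : Finset Y) (A : ℕ → X → Finset Y),
      (∀ k x, (A k x).Nonempty) ∧
      (∀ k ≤ n + 1, ∀ x, A k x ⊆ F) ∧ (∀ k ≤ n + 1, ∀ x, (A k x).card ≤ c * (n + 1)) ∧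
      (∀ k x, A k x ⊆ A (k + 1) x) ∧
      (∀ s ∈ E, ∀ k x, (A k x).image (s • ·) ⊆ A (k + 1) (s • x)) ∧
      ∀ s ∈ E, ∀ k x, A k (s • x) ⊆ (A (k + 1) x).image (s • ·)) :
    HasReiterMaps G X Y := by
  intro E ε hε
  obtain ⟨c, h⟩ := h E
  -- The errors telescope to at most `4 * log (c * (n + 1))`. As `c` is independent of `n`, this is
  -- small against `n`.
  obtain ⟨n, hn, hlog⟩ : ∃ n : ℕ, 1 ≤ n ∧ 4 * Real.log (c * (n + 1 : ℕ)) ≤ ε * n := by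
    rcases Nat.eq_zero_or_pos c with rfl | hc
    · exact ⟨1, le_rfl, by simp [hε.le]⟩
    have hc' : (0 : ℝ) < c := by exact_mod_cast hc
    have h1 := Real.isLittleO_log_id_atTop.bound (show 0 < ε / (8 * c) by positivity)
    have h2 : Tendsto (fun n : ℕ => (c : ℝ) * (n + 1 : ℕ)) atTop atTop :=
      (tendsto_natCast_atTop_atTop.comp (tendsto_add_atTop_nat 1)).const_mul_atTop hc'
    obtain ⟨n, hn1, hn2⟩ := ((h2.eventually h1).and (eventually_ge_atTop 1)).exists
    refine ⟨n, hn2, ?_⟩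
    have h3 := (le_abs_self _).trans hn1
    rw [id, Real.norm_of_nonneg (by positivity)] at h3
    have h4 : ε / (8 * c) * (c * (n + 1 : ℕ)) = ε * (n + 1) / 8 := by
      push_cast
      field_simp
    rw [h4] at h3
    have h5 : (1 : ℝ) ≤ n := by exact_mod_cast hn2
    nlinarith
  have hn0 : (0 : ℝ) < n := by exact_mod_cast hn
  obtain ⟨F, A, hne, hF, hcard, hmono, h1, h2⟩ := h n
  let u : Finset Y → Y → ℝ := fun B t => if t ∈ B then (B.card : ℝ)⁻¹ else 0
  refine ⟨F, fun x t => (n : ℝ)⁻¹ * ∑ i ∈ Finset.range n, u (A (i + 1) x) t, fun x t => ?_,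
    fun x t ht => ?_, fun x => ?_, fun s hs x W => ?_⟩
  · refine mul_nonneg (by positivity) (Finset.sum_nonneg fun i _ => ?_)
    simp only [u]
    positivity
  · dsimp only
    rw [Finset.sum_eq_zero, mul_zero]
    intro i hi
    rw [Finset.mem_range] at hi
    exact if_neg fun h' => ht (hF (i + 1) (by lia) x h')
  · rw [← Finset.mul_sum, Finset.sum_comm, Finset.sum_congr rfl (g := fun _ => (1 : ℝ))]
    · simp [hn0.ne']
    · intro i hi
      rw [Finset.mem_range] at hi
      simp only [u]
      rw [Finset.sum_ite_mem, Finset.inter_eq_right.2 (hF (i + 1) (by lia) x), Finset.sum_const,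
        nsmul_eq_mul, mul_inv_cancel₀]
      exact_mod_cast (hne _ _).card_pos.ne'
  · let l : ℕ → ℝ := fun i => Real.log (A i (s • x)).card
    have hl0 : ∀ i, 0 ≤ l i := fun i => Real.log_natCast_nonneg _
    have hl : ∀ i ≤ n + 1, l i ≤ Real.log (c * (n + 1 : ℕ)) := fun i hi => by
      refine Real.log_le_log (by exact_mod_cast (hne _ _).card_pos) ?_
      exact_mod_cast hcard i hi (s • x)
    have htr : ∀ i t, u (A (i + 1) x) (s⁻¹ • t) = u ((A (i + 1) x).image (s • ·)) t := fun i t => by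
      simp only [u]
      rw [Finset.card_image_of_injective _ (MulAction.injective s)]
      congr 1
      rw [Finset.mem_image, eq_iff_iff]
      constructor
      · exact fun ht => ⟨_, ht, smul_inv_smul _ _⟩
      · rintro ⟨y, hy, rfl⟩
        rwa [inv_smul_smul]
    -- Both the translate of `A (i + 1) x` and `A (i + 1) (s • x)` lie between `A i (s • x)` and `A
    -- (i + 2) (s • x)`.
    have hi : ∀ i, ∑ t ∈ W, |u (A (i + 1) x) (s⁻¹ • t) - u (A (i + 1) (s • x)) t| ≤
        2 * (l (i + 2) - l i) := fun i => by
      simp only [htr]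
      refine sum_abs_uniform_sub_uniform_le ?_ (hmono i _) (h1 s hs (i + 1) x) (hmono (i + 1) _)
        (hne _ _) W
      exact h2 s hs i x
    calc _ ≤ ∑ t ∈ W, (n : ℝ)⁻¹ * ∑ i ∈ Finset.range n,
            |u (A (i + 1) x) (s⁻¹ • t) - u (A (i + 1) (s • x)) t| := by
          refine Finset.sum_le_sum fun t _ => ?_
          rw [← mul_sub, ← Finset.sum_sub_distrib, abs_mul, abs_of_pos (inv_pos.2 hn0)]
          exact mul_le_mul_of_nonneg_left (Finset.abs_sum_le_sum_abs _ _) (inv_pos.2 hn0).le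
      _ = (n : ℝ)⁻¹ * ∑ i ∈ Finset.range n, ∑ t ∈ W,
            |u (A (i + 1) x) (s⁻¹ • t) - u (A (i + 1) (s • x)) t| := by
          rw [← Finset.mul_sum, Finset.sum_comm]
      _ ≤ (n : ℝ)⁻¹ * ∑ i ∈ Finset.range n, 2 * (l (i + 2) - l i) :=
          mul_le_mul_of_nonneg_left (Finset.sum_le_sum fun i _ => hi i) (inv_pos.2 hn0).le
      _ = (n : ℝ)⁻¹ * (2 * ((l (n + 1) - l 1) + (l n - l 0))) := by
          rw [← Finset.mul_sum, ← Finset.sum_range_sub l, ← Finset.sum_range_sub (fun i => l (i + 1)),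
            ← Finset.sum_add_distrib]
          simp only [sub_add_sub_cancel]
      _ ≤ (n : ℝ)⁻¹ * (4 * Real.log (c * (n + 1 : ℕ))) := by
          refine mul_le_mul_of_nonneg_left ?_ (inv_pos.2 hn0).le
          have := hl (n + 1) le_rfl
          have := hl n (by lia)
          have := hl0 0
          have := hl0 1
          linarith
      _ ≤ (n : ℝ)⁻¹ * (ε * n) := mul_le_mul_of_nonneg_left hlog (inv_pos.2 hn0).le
      _ = ε := by field_simp

/-! ### Short walks, arcs and small turns. -/

namespace SimpleGraph

section Joined

variable {V : Type*} {K : SimpleGraph V} {P Q : V → Prop} {L L' : ℕ} {u v w : V}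

/-- `u` and `w` are joined by a walk of length at most `L` through vertices satisfying `P`. -/
def JoinedIn (K : SimpleGraph V) (P : V → Prop) (L : ℕ) (u w : V) : Prop :=
  ∃ p : K.Walk u w, p.length ≤ L ∧ ∀ z ∈ p.support, P z

theorem JoinedIn.refl (h : P u) : K.JoinedIn P L u u :=
  ⟨.nil, by simp, by simpa using h⟩

theorem JoinedIn.symm (h : K.JoinedIn P L u w) : K.JoinedIn P L w u := by
  obtain ⟨p, h1, h2⟩ := h
  exact ⟨p.reverse, by simpa using h1, by simpa using h2⟩

theorem JoinedIn.trans (h : K.JoinedIn P L u v) (h' : K.JoinedIn P L' v w) :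
    K.JoinedIn P (L + L') u w := by
  obtain ⟨p, h1, h2⟩ := h
  obtain ⟨q, h3, h4⟩ := h'
  refine ⟨p.append q, by rw [Walk.length_append]; lia, fun z hz => ?_⟩
  rw [Walk.mem_support_append_iff] at hz
  exact hz.elim (h2 z) (h4 z)

theorem JoinedIn.mono (h : K.JoinedIn P L u w) (hL : L ≤ L') (hPQ : ∀ z, P z → Q z) :
    K.JoinedIn Q L' u w := by
  obtain ⟨p, h1, h2⟩ := h
  exact ⟨p, h1.trans hL, fun z hz => hPQ z (h2 z hz)⟩

theorem JoinedIn.of_adj (h : K.Adj u w) (hu : P u) (hw : P w) : K.JoinedIn P 1 u w := by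
  refine ⟨.cons h .nil, by simp, fun z hz => ?_⟩
  simp only [Walk.support_cons, Walk.support_nil, List.mem_cons, List.not_mem_nil, or_false] at hz
  rcases hz with rfl | rfl
  exacts [hu, hw]

/-- A walk that ends in `B` contains a path whose only vertex in `B` is its end. -/
theorem JoinedIn.exists_isPath {B : Set V} (h : K.JoinedIn P L u w) (hw : w ∈ B) :
    ∃ b ∈ B, ∃ p : K.Walk u b, p.IsPath ∧ p.length ≤ L ∧ (∀ z ∈ p.support, P z) ∧
      ∀ z ∈ p.support, z ∈ B → z = b := by
  classical
  obtain ⟨p, h1, h2⟩ := h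
  induction p generalizing L with
  | nil => exact ⟨_, hw, .nil, by simp, by simp, h2, by simp⟩
  | @cons a c d hac p ih =>
    by_cases ha : a ∈ B
    · exact ⟨a, ha, .nil, by simp, by simp, by simpa using h2 a (by simp), by simp⟩
    obtain ⟨b, hb, q, hq, hql, hqP, hqB⟩ := ih (L := p.length) hw le_rfl
      (fun z hz => h2 z (by simp [hz]))
    rw [Walk.length_cons] at h1
    -- If the path returns to `a`, the loop at `a` is cut off.
    by_cases haq : a ∈ q.support
    · refine ⟨b, hb, q.dropUntil a haq, hq.dropUntil haq, ?_, fun z hz => hqP z ?_,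
        fun z hz => hqB z ?_⟩
      · exact (q.length_dropUntil_le_length haq).trans (by lia)
      · exact q.support_dropUntil_subset_support haq hz
      · exact q.support_dropUntil_subset_support haq hz
    · refine ⟨b, hb, .cons hac q, hq.cons haq, ?_, fun z hz => ?_, fun z hz hzB => ?_⟩
      · rw [Walk.length_cons]; lia
      · rw [Walk.support_cons, List.mem_cons] at hz
        rcases hz with rfl | hz
        · exact h2 z (by simp)
        · exact hqP z hz
      · rw [Walk.support_cons, List.mem_cons] at hz
        rcases hz with rfl | hz
        · exact absurd hzB ha
        · exact hqB z hz hzB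

theorem Walk.IsPath.append_of_inter {p : K.Walk u v} {q : K.Walk v w} (hp : p.IsPath)
    (hq : q.IsPath) (h : ∀ z ∈ p.support, z ∈ q.support → z = v) : (p.append q).IsPath := by
  rw [Walk.isPath_def, Walk.support_append, List.nodup_append']
  have hq' := hq.support_nodup
  rw [← q.cons_tail_support, List.nodup_cons] at hq'
  refine ⟨hp.support_nodup, hq'.2, fun z hz hz' => ?_⟩
  have := h z hz (List.mem_of_mem_tail hz')
  exact hq'.1 (this ▸ hz')

/-- A walk that passes through `v` reaches `v` for the first time along one of its edges. -/
theorem Walk.exists_joinedIn_of_mem_support (p : K.Walk u w) (hv : v ∈ p.support) (hne : u ≠ v) :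
    ∃ z, K.JoinedIn (· ≠ v) p.length u z ∧ s(z, v) ∈ p.edges := by
  induction p with
  | nil => simp only [Walk.support_nil, List.mem_singleton] at hv; exact absurd hv.symm hne
  | @cons a c d hac p ih =>
    by_cases hcv : c = v
    · subst hcv
      exact ⟨a, .refl hne, by simp⟩
    · rw [Walk.support_cons, List.mem_cons] at hv
      obtain ⟨z, h1, h2⟩ := ih (hv.resolve_left hne.symm) hcv
      refine ⟨z, ?_, by simp [h2]⟩
      rw [Walk.length_cons, add_comm]
      exact (JoinedIn.of_adj hac hne hcv).trans h1

end Joined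

section Arcs

variable {V : Type*} {K : SimpleGraph V}

/-- The vertices on paths of length at most `L` from `a` to `b`. -/
def arcVertices (K : SimpleGraph V) (L : ℕ) (a b : V) : Set V :=
  {y | ∃ p : K.Walk a b, p.IsPath ∧ p.length ≤ L ∧ y ∈ p.support}

/-- The edge from `b` to `a` closes a path from `a` to `b` to a circuit of length at most `L + 1`,
unless the path is that edge itself and has only the vertices `a` and `b`. -/
theorem IsFineGraph.finite_arcVertices {V : Type u} {K : SimpleGraph V} (hK : K.IsFineGraph)
    {a b : V} (h : K.Adj a b) (L : ℕ) :
    (K.arcVertices L a b).Finite := by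
  have hfin := hK (L + 1) s(b, a) h.symm
  refine ((hfin.biUnion fun c _ => c.2.support.finite_toSet).union
    (Set.toFinite ({a, b} : Set V))).subset ?_
  rintro y ⟨p, hp, hpL, hy⟩
  by_cases hy' : y = a ∨ y = b
  · exact Or.inr hy'
  rw [not_or] at hy'
  refine Or.inl ?_
  have he : s(b, a) ∉ p.edges := by
    cases p with
    | nil => simp at hy; exact absurd hy hy'.1
    | @cons _ c _ hac q =>
      rw [Walk.cons_isPath_iff] at hp
      intro he
      rw [Walk.edges_cons, List.mem_cons] at he
      rcases he with he | he
      · rw [Sym2.eq_swap, Sym2.congr_right] at he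
        subst he
        rw [Walk.isPath_iff_nil, ← Walk.eq_nil_iff_nil] at hp
        rw [hp.1] at hy
        simp [hy'.1, hy'.2] at hy
      · exact hp.2 (Walk.snd_mem_support_of_mem_edges _ he)
  rw [Set.mem_iUnion₂]
  refine ⟨⟨b, .cons h.symm p⟩, ⟨(Walk.cons_isCycle_iff _ _).2 ⟨hp, he⟩, ?_, by simp⟩, ?_⟩
  · simpa using hpL
  · exact List.mem_cons_of_mem _ hy

/-- Two edges at `v` make a small turn if their other ends are joined by a short walk avoiding
`v`. -/
def SmallTurn (K : SimpleGraph V) (L : ℕ) (v w w' : V) : Prop :=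
  K.Adj v w ∧ K.Adj v w' ∧ K.JoinedIn (· ≠ v) L w w'

/-- A path from `w` to `w'` avoiding `v` is prolonged by the edge from `w'` to `v`. Hence, in a fine
graph, an edge at `v` has finitely many small turns. -/
theorem SmallTurn.mem_arcVertices {L : ℕ} {v w w' : V} (h : K.SmallTurn L v w w') :
    w' ∈ K.arcVertices (L + 1) w v := by
  obtain ⟨h1, h2, h3⟩ := h
  obtain ⟨b, rfl, p, hp, hpl, hpv, -⟩ := h3.exists_isPath (B := {w'}) rfl
  refine ⟨p.concat h2.symm, ?_, by simpa using hpl, ?_⟩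
  · rw [Walk.concat_isPath_iff]
    exact ⟨hp, fun h => hpv _ h rfl⟩
  · simp [Walk.support_concat]

theorem IsFineGraph.finite_smallTurn {V : Type u} {K : SimpleGraph V} (hK : K.IsFineGraph)
    (L : ℕ) (v w : V) :
    {w' | K.SmallTurn L v w w'}.Finite := by
  by_cases h : K.Adj v w
  · exact (hK.finite_arcVertices h.symm (L + 1)).subset fun w' hw' => hw'.mem_arcVertices
  · exact Set.Finite.subset Set.finite_empty fun w' hw' => h hw'.1

end Arcs

/-! ### Geodesics and thin triangles. -/

section Geodesics

variable {V : Type u} {K : SimpleGraph V} {α β : ℕ → V} {a b i j : ℕ}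

theorem IsGeodesicPath.dist_eq (h : K.IsGeodesicPath α a) (hij : i ≤ j) (hj : j ≤ a) :
    K.dist (α i) (α j) = j - i := by
  have h1 := h i (hij.trans hj) j hj
  rw [abs_sub_comm, abs_of_nonneg (by simpa using hij), ← Nat.cast_sub hij] at h1
  exact_mod_cast h1

theorem IsGeodesicPath.adj (h : K.IsGeodesicPath α a) (hi : i + 1 ≤ a) :
    K.Adj (α i) (α (i + 1)) := by
  rw [← dist_eq_one_iff_adj, h.dist_eq (Nat.le_succ i) hi]
  lia

theorem IsGeodesicPath.joinedIn (h : K.IsGeodesicPath α a) (hij : i ≤ j) (hj : j ≤ a) :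
    K.JoinedIn (fun z => ∃ t, i ≤ t ∧ t ≤ j ∧ z = α t) (j - i) (α i) (α j) := by
  induction j, hij using Nat.le_induction with
  | base => exact .refl ⟨i, le_rfl, le_rfl, rfl⟩
  | succ j hij ih =>
    have h1 : K.JoinedIn (fun z => ∃ t, i ≤ t ∧ t ≤ j + 1 ∧ z = α t) 1 (α j) (α (j + 1)) :=
      .of_adj (h.adj hj) ⟨j, hij, by lia, rfl⟩ ⟨j + 1, by lia, le_rfl, rfl⟩
    refine (((ih (by lia)).mono le_rfl ?_).trans h1).mono (by lia) fun z hz => hz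
    rintro z ⟨t, h1, h2, h3⟩
    exact ⟨t, h1, by lia, h3⟩

theorem IsGeodesicPath.injOn (h : K.IsGeodesicPath α a) (hi : i ≤ a) (hj : j ≤ a)
    (hij : α i = α j) : i = j := by
  have h1 := h i hi j hj
  rw [hij, dist_self, eq_comm, Nat.cast_zero, abs_eq_zero, sub_eq_zero] at h1
  exact_mod_cast h1

theorem Connected.exists_isGeodesicPath (hK : K.Connected) (x y : V) :
    ∃ (α : ℕ → V) (a : ℕ), K.IsGeodesicPath α a ∧ α 0 = x ∧ α a = y := by
  obtain ⟨p, hp⟩ := hK.exists_walk_length_eq_dist x y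
  have hle : ∀ i j, i ≤ j → j ≤ p.length → K.dist (p.getVert i) (p.getVert j) ≤ j - i := by
    intro i j hij
    induction j, hij using Nat.le_induction with
    | base => simp
    | succ j hij ih =>
      intro hj
      have h1 := dist_eq_one_iff_adj.2 (p.adj_getVert_succ (i := j) (by lia))
      have h2 := hK.dist_triangle (u := p.getVert i) (v := p.getVert j) (w := p.getVert (j + 1))
      have := ih (by lia)
      lia
  have heq : ∀ i j, i ≤ j → j ≤ p.length → K.dist (p.getVert i) (p.getVert j) = j - i := by
    intro i j hij hj
    have h1 := hle 0 i (Nat.zero_le _) (hij.trans hj)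
    have h2 := hle i j hij hj
    have h3 := hle j p.length hj le_rfl
    rw [Walk.getVert_zero] at h1
    rw [Walk.getVert_length] at h3
    have h4 := hK.dist_triangle (u := x) (v := p.getVert i) (w := y)
    have h5 := hK.dist_triangle (u := p.getVert i) (v := p.getVert j) (w := y)
    lia
  refine ⟨p.getVert, p.length, fun i hi j hj => ?_, by simp, by simp⟩
  rcases le_total i j with hij | hij
  · rw [heq i j hij hj, abs_sub_comm, abs_of_nonneg (by simpa using hij), Nat.cast_sub hij]
  · rw [dist_comm, heq j i hij hi, abs_of_nonneg (by simpa using hij), Nat.cast_sub hij]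

theorem Connected.joinedIn_dist (hK : K.Connected) (x y : V) :
    K.JoinedIn (fun z => K.dist x z ≤ K.dist x y) (K.dist x y) x y := by
  obtain ⟨α, a, hα, rfl, rfl⟩ := hK.exists_isGeodesicPath x y
  have h1 := hα.dist_eq (Nat.zero_le a) le_rfl
  refine (hα.joinedIn (Nat.zero_le a) le_rfl).mono h1.ge ?_
  rintro z ⟨t, -, ht, rfl⟩
  rw [h1, hα.dist_eq (Nat.zero_le t) ht]
  lia

/-- Geodesic triangles are `D`-thin. -/
def IsThin (K : SimpleGraph V) (D : ℕ) : Prop :=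
  ∀ (α β : ℕ → V) (a b : ℕ), K.IsGeodesicPath α a → K.IsGeodesicPath β b → α 0 = β 0 →
    ∀ k, 2 * k + K.dist (α a) (β b) ≤ a + b → K.dist (α k) (β k) ≤ D

theorem IsHyperbolicGraph.exists_isThin (hK : K.IsHyperbolicGraph) : ∃ D, K.IsThin D := by
  obtain ⟨-, δ, -, h⟩ := hK
  refine ⟨⌈δ⌉₊, fun α β a b hα hβ h0 k hk => ?_⟩
  have h1 := h α β a b hα hβ h0 k ?_
  · exact_mod_cast h1.le.trans (Nat.le_ceil δ)
  · rw [gromovProduct, dist_comm (u := α a), hα.dist_eq (Nat.zero_le a) le_rfl, h0,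
      dist_comm (u := β b), hβ.dist_eq (Nat.zero_le b) le_rfl, Nat.sub_zero, Nat.sub_zero,
      le_div_iff₀ two_pos]
    have : (2 * k + K.dist (α a) (β b) : ℝ) ≤ a + b := by exact_mod_cast hk
    linarith

/-- Two paths from `y` to a geodesic that only meet in `y` yield a circuit through `y` and an edge
of the geodesic. -/
theorem IsGeodesicPath.mem_arcVertices {y : V} {p q : ℕ} {P : K.Walk y (β p)} {Q : K.Walk y (β q)}
    (hβ : K.IsGeodesicPath β b) (hpq : p < q) (hq : q ≤ b) (hP : P.IsPath) (hQ : Q.IsPath)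
    (hPβ : ∀ z ∈ P.support, z ∈ β '' Set.Iic b → z = β p)
    (hQβ : ∀ z ∈ Q.support, z ∈ β '' Set.Iic b → z = β q)
    (hPQ : ∀ z ∈ P.support, z ∈ Q.support → z = y) :
    y ∈ K.arcVertices (P.length + Q.length + (q - p)) (β p) (β (p + 1)) := by
  -- `R` runs back along the geodesic from `β q` to `β (p + 1)`; the arc is `P` reversed, then `Q`,
  -- then `R`.
  obtain ⟨_, rfl, R, hR, hRl, hRβ, -⟩ :=
    (hβ.joinedIn (i := p + 1) hpq hq).symm.exists_isPath (B := {β (p + 1)}) rfl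
  have hQR : (Q.append R).IsPath := hQ.append_of_inter hR fun z hz hz' => by
    obtain ⟨t, -, ht, rfl⟩ := hRβ z hz'
    exact hQβ _ hz ⟨t, ht.trans hq, rfl⟩
  refine ⟨P.reverse.append (Q.append R), hP.reverse.append_of_inter hQR fun z hz hz' => ?_, ?_, ?_⟩
  · rw [Walk.support_reverse, List.mem_reverse] at hz
    rw [Walk.mem_support_append_iff] at hz'
    rcases hz' with hz' | hz'
    · exact hPQ z hz hz'
    · obtain ⟨t, ht, ht', rfl⟩ := hRβ z hz'
      have h1 := hβ.injOn (ht'.trans hq) (by lia) (hPβ _ hz ⟨t, ht'.trans hq, rfl⟩)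
      lia
  · simp only [Walk.length_append, Walk.length_reverse]
    lia
  · simp

end Geodesics

end SimpleGraph

/-! ### Two geodesics with the same origin and close ends. -/

namespace SimpleGraph

variable {V : Type u} {K : SimpleGraph V} {α β : ℕ → V} {a b D : ℕ}

/-- Away from its end, a geodesic which does not meet a second geodesic with the same origin and a
close end is joined to it by a short path on either side. -/
theorem IsGeodesicPath.joinedIn_image (hK : K.Connected) (hD : K.IsThin D)
    (hα : K.IsGeodesicPath α a) (hβ : K.IsGeodesicPath β b) (h0 : α 0 = β 0) {i j : ℕ}
    (hj : 2 * j + K.dist (α a) (β b) ≤ a + b)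
    (hij : K.JoinedIn (fun z => ∃ t, min i j ≤ t ∧ t ≤ max i j ∧ z = α t) (D + 1) (α i) (α j)) :
    K.JoinedIn (fun z => (∃ t, min i j ≤ t ∧ t ≤ max i j ∧ z = α t) ∨
      0 < j ∧ K.dist (α j) z ≤ D) (2 * D + 1) (α i) (β j) := by
  have h1 := hD α β a b hα hβ h0 j hj
  rcases Nat.eq_zero_or_pos j with rfl | hj0
  · rw [← h0]
    exact hij.mono (by lia) fun z hz => Or.inl hz
  · exact ((hij.mono le_rfl fun z hz => Or.inl hz).trans
      ((hK.joinedIn_dist (α j) (β j)).mono h1 fun z hz => Or.inr ⟨hj0, hz.trans h1⟩)).mono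
        (by lia) fun z hz => hz

/-- From `α k` go `D + 1` steps along `α` in either direction, then cross to `β` within distance
`D`. The crossings start `2 * D + 2` apart, so the two routes meet only in `α k` and close up along
`β` to a circuit. Each route has length at most `2 * D + 1` and their ends are at most `4 * D + 2`
apart, whence `8 * D + 4`. If the way back is cut short at the common origin, no crossing is needed
there. -/
theorem IsGeodesicPath.exists_mem_arcVertices (hK : K.Connected) (hD : K.IsThin D)
    (hα : K.IsGeodesicPath α a) (hβ : K.IsGeodesicPath β b) (h0 : α 0 = β 0) {k r : ℕ}
    (hr : K.dist (α a) (β b) ≤ r) (hk : k + (D + 1) + r ≤ a) (hkβ : α k ∉ β '' Set.Iic b) :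
    ∃ j < b, k ≤ j + (2 * D + 1) ∧ α k ∈ K.arcVertices (8 * D + 4) (β j) (β (j + 1)) := by
  have hab : a ≤ b + r := by
    have h1 := hα.dist_eq (Nat.zero_le a) le_rfl
    have h2 := hβ.dist_eq (Nat.zero_le b) le_rfl
    have h3 := hK.dist_triangle (u := β 0) (v := β b) (w := α a)
    rw [dist_comm (u := β b)] at h3
    rw [h0] at h1
    lia
  have hjl : K.JoinedIn (fun z => ∃ t, min k (k + (D + 1)) ≤ t ∧ t ≤ max k (k + (D + 1)) ∧ z = α t)
      (D + 1) (α k) (α (k + (D + 1))) :=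
    (hα.joinedIn (Nat.le_add_right k (D + 1)) (by lia)).mono (by lia) fun z ⟨t, h1, h2, h3⟩ =>
      ⟨t, by lia, by lia, h3⟩
  have hjr : K.JoinedIn (fun z => ∃ t, min k (k - (D + 1)) ≤ t ∧ t ≤ max k (k - (D + 1)) ∧ z = α t)
      (D + 1) (α k) (α (k - (D + 1))) :=
    ((hα.joinedIn (Nat.sub_le k (D + 1)) (by lia)).mono (by lia) fun z ⟨t, h1, h2, h3⟩ =>
      ⟨t, by lia, by lia, h3⟩).symm
  obtain ⟨_, ⟨p, hp, rfl⟩, P, hP, hPl, hPU, hPβ⟩ :=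
    (hα.joinedIn_image hK hD hβ h0 (by lia) hjl).exists_isPath
      (B := β '' Set.Iic b) ⟨_, by simp only [Set.mem_Iic]; lia, rfl⟩
  obtain ⟨_, ⟨q, hq, rfl⟩, Q, hQ, hQl, hQU, hQβ⟩ :=
    (hα.joinedIn_image hK hD hβ h0 (by lia) hjr).exists_isPath
      (B := β '' Set.Iic b) ⟨_, by simp only [Set.mem_Iic]; lia, rfl⟩
  rw [Set.mem_Iic] at hp hq
  have hPQ : ∀ z ∈ P.support, z ∈ Q.support → z = α k := by
    intro z hz hz'
    rcases hPU z hz with ⟨t, ht, ht', rfl⟩ | ⟨-, hz1⟩ <;>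
      rcases hQU _ hz' with ⟨t', hs, hs', hst⟩ | ⟨hk0, hz2⟩
    · have := hα.injOn (i := t) (j := t') (by lia) (by lia) hst
      congr 1
      lia
    · have := hα.dist_eq (i := k - (D + 1)) (j := t) (by lia) (by lia)
      lia
    · subst hst
      have := hα.dist_eq (i := t') (j := k + (D + 1)) (by lia) (by lia)
      rw [dist_comm] at this
      lia
    · have h1 := hα.dist_eq (i := k - (D + 1)) (j := k + (D + 1)) (by lia) (by lia)
      have h2 := hK.dist_triangle (u := α (k - (D + 1))) (v := z) (w := α (k + (D + 1)))
      rw [dist_comm (u := z)] at h2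
      lia
  have hdp : K.dist (α k) (β p) ≤ 2 * D + 1 := (dist_le P).trans hPl
  have hdq : K.dist (α k) (β q) ≤ 2 * D + 1 := (dist_le Q).trans hQl
  have hkx : K.dist (β 0) (α k) = k := by
    rw [← h0, hα.dist_eq (Nat.zero_le k) (by lia), Nat.sub_zero]
  have hnear : ∀ j ≤ b, K.dist (α k) (β j) ≤ 2 * D + 1 → k ≤ j + (2 * D + 1) := by
    intro j hj hkj
    have h1 := hβ.dist_eq (Nat.zero_le j) hj
    have h2 := hK.dist_triangle (u := β 0) (v := β j) (w := α k)
    rw [dist_comm (u := β j)] at h2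
    lia
  have hpqd : K.dist (β p) (β q) ≤ 4 * D + 2 := by
    have h2 := hK.dist_triangle (u := β p) (v := α k) (w := β q)
    rw [dist_comm (u := β p) (v := α k)] at h2
    lia
  have hmono : ∀ {L u w}, L ≤ 8 * D + 4 → α k ∈ K.arcVertices L u w →
      α k ∈ K.arcVertices (8 * D + 4) u w := fun hL ⟨p, h1, h2, h3⟩ => ⟨p, h1, h2.trans hL, h3⟩
  rcases lt_trichotomy p q with hpq | rfl | hpq
  · have := hβ.dist_eq hpq.le hq
    exact ⟨p, by lia, hnear p hp hdp,
      hmono (by lia) (hβ.mem_arcVertices hpq hq hP hQ hPβ hQβ hPQ)⟩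
  · have := hPQ _ P.end_mem_support Q.end_mem_support
    exact absurd ⟨p, hp, this⟩ hkβ
  · have := hβ.dist_eq hpq.le hp
    rw [dist_comm] at this
    exact ⟨q, by lia, hnear q hq hdq, hmono (by lia)
      (hβ.mem_arcVertices hpq hp hQ hP hQβ hPβ fun z hz hz' => hPQ z hz' hz)⟩

/-- From a vertex of the first geodesic which is not on the second one, one can reach the end of
the second geodesic without returning to this vertex. -/
theorem IsGeodesicPath.joinedIn_avoiding (hK : K.Connected) (hD : K.IsThin D)
    (hα : K.IsGeodesicPath α a) (hβ : K.IsGeodesicPath β b) (h0 : α 0 = β 0) {k r N : ℕ}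
    (hr : K.dist (α a) (β b) ≤ r) (hk0 : 0 < k) (hka : k ≤ a) (hkN : a ≤ k + N)
    (hkβ : α k ∉ β '' Set.Iic b) :
    K.JoinedIn (· ≠ α k) (N + 3 * r + 3 * D + 2) (α (k - 1)) (β b) := by
  have h1 := hα.dist_eq (Nat.zero_le a) le_rfl
  have h2 := hβ.dist_eq (Nat.zero_le b) le_rfl
  rw [h0] at h1
  have hab : a ≤ b + r := by
    have h3 := hK.dist_triangle (u := β 0) (v := β b) (w := α a)
    rw [dist_comm (u := β b)] at h3
    lia
  have hba : b ≤ a + r := by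
    have h3 := hK.dist_triangle (u := β 0) (v := α a) (w := β b)
    lia
  have hd : K.dist (α a) (β b) ≤ a + b := by
    have h3 := hK.dist_triangle (u := α a) (v := β 0) (w := β b)
    rw [dist_comm (u := α a) (v := β 0)] at h3
    lia
  -- The route goes back to `α i`, crosses to `β i` and follows `β`. The crossing stays within `D`
  -- of `α i`, hence away from `α k`; if the subtraction truncates to `0`, the two geodesics agree
  -- there.
  obtain ⟨i, hi⟩ : ∃ i, i = k - (r + D + 1) := ⟨_, rfl⟩
  have hαi : K.JoinedIn (· ≠ α k) (r + D) (α (k - 1)) (α i) := by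
    refine ((hα.joinedIn (show i ≤ k - 1 by lia) (by lia)).mono (by lia) ?_).symm
    rintro z ⟨t, -, ht, rfl⟩ h
    have := hα.injOn (by lia) hka h
    lia
  have hthin := hD α β a b hα hβ h0 i (by lia)
  have hi_β : K.JoinedIn (· ≠ α k) D (α i) (β i) := by
    rcases Nat.eq_zero_or_pos i with rfl | hi0
    · rw [← h0]
      refine JoinedIn.refl (P := (· ≠ α k)) fun h => ?_
      have := hα.injOn (Nat.zero_le a) hka h
      lia
    · refine (hK.joinedIn_dist (α i) (β i)).mono hthin ?_
      rintro z hz rfl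
      have := hα.dist_eq (show i ≤ k by lia) hka
      lia
  have hβb : K.JoinedIn (· ≠ α k) (b - i) (β i) (β b) := by
    refine (hβ.joinedIn (show i ≤ b by lia) le_rfl).mono le_rfl ?_
    rintro z ⟨t, -, ht, rfl⟩ h
    exact hkβ ⟨t, ht, h⟩
  exact ((hαi.trans hi_β).trans hβb).mono (by lia) fun z hz => hz

end SimpleGraph

namespace SimpleGraph

/-! ### Stop sets: finiteness and linear growth. -/

section StopSet

variable {V : Type u} {K : SimpleGraph V} {T : V → V → V → Prop} {N : ℕ} {o w x : V}

/-- The vertices at which a traveller who arrives in `o` from `w` and proceeds along a geodesic to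
`x` may stop: he stops in `x`, or after `N` steps, or as soon as he would have to make a turn which
is not allowed by `T`. The geodesics are parametrized from `x` to `o`. -/
def stopSet (K : SimpleGraph V) (T : V → V → V → Prop) (N : ℕ) (o w x : V) : Set V :=
  {v | ∃ (α : ℕ → V) (a k : ℕ), K.IsGeodesicPath α a ∧ α 0 = x ∧ α a = o ∧ α (a + 1) = w ∧
    k ≤ a ∧ a ≤ k + N ∧ (k = 0 ∨ a = k + N ∨ ¬T (α k) (α (k + 1)) (α (k - 1))) ∧
    (∀ j, k < j → j ≤ a → T (α j) (α (j + 1)) (α (j - 1))) ∧ v = α k}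

theorem Connected.nonempty_stopSet (hK : K.Connected) (T : V → V → V → Prop) (N : ℕ) (o w x : V) :
    (K.stopSet T N o w x).Nonempty := by
  classical
  obtain ⟨α, a, hα, h0, ha⟩ := hK.exists_isGeodesicPath x o
  -- The value at `a + 1`, beyond the geodesic, records where the traveller came from.
  let α' := Function.update α (a + 1) w
  have heq : ∀ i ≤ a, α' i = α i := fun i hi => Function.update_of_ne (by lia) _ _
  let P : ℕ → Prop := fun k => k = 0 ∨ a = k + N ∨ ¬T (α' k) (α' (k + 1)) (α' (k - 1))
  refine ⟨_, α', a, Nat.findGreatest P a, fun i hi j hj => ?_, ?_, ?_, Function.update_self .., ?_,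
    ?_, Nat.findGreatest_spec (P := P) (Nat.zero_le a) (Or.inl rfl), fun j hj hja => ?_, rfl⟩
  · rw [heq i hi, heq j hj]
    exact hα i hi j hj
  · rw [heq 0 (Nat.zero_le a), h0]
  · rw [heq a le_rfl, ha]
  · exact Nat.findGreatest_le a
  · rcases le_total a N with h | h
    · lia
    · have := Nat.le_findGreatest (P := P) (Nat.sub_le a N) (Or.inr (Or.inl (by lia)))
      lia
  · by_contra hT
    exact Nat.findGreatest_is_greatest hj hja (Or.inr (Or.inr hT))

/-- The oriented edges at which a traveller can be after `i` allowed turns. -/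
def reachableDarts (T : V → V → V → Prop) (o w : V) : ℕ → Set (V × V)
  | 0 => {(o, w)}
  | i + 1 => ⋃ d ∈ reachableDarts T o w i, (fun u => (u, d.1)) '' {u | T d.1 d.2 u}

theorem finite_reachableDarts (hT : ∀ v w, {w' | T v w w'}.Finite) (o w : V) (i : ℕ) :
    (reachableDarts T o w i).Finite := by
  induction i with
  | zero => exact Set.finite_singleton _
  | succ i ih => exact ih.biUnion fun d _ => (hT d.1 d.2).image _

/-- At most `N` steps are made, each with finitely many choices that do not depend on the
destination `x`. -/
theorem exists_finite_stopSet_subset (K : SimpleGraph V) (hT : ∀ v w, {w' | T v w w'}.Finite)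
    (N : ℕ) (o w : V) : ∃ F : Set V, F.Finite ∧ ∀ x, K.stopSet T N o w x ⊆ F := by
  refine ⟨⋃ i ∈ Set.Iic N, Prod.fst '' reachableDarts T o w i, (Set.finite_Iic N).biUnion fun i _ =>
    (finite_reachableDarts hT o w i).image _, ?_⟩
  rintro x _ ⟨α, a, k, -, -, rfl, rfl, hka, hkN, -, hkT, rfl⟩
  have h : ∀ i ≤ a - k, (α (a - i), α (a - i + 1)) ∈ reachableDarts T (α a) (α (a + 1)) i := by
    intro i
    induction i with
    | zero => intro _; exact Set.mem_singleton _
    | succ i ih =>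
      intro hi
      refine Set.mem_biUnion (ih (by lia)) ⟨_, hkT (a - i) (by lia) (by lia), ?_⟩
      rw [show a - i - 1 = a - (i + 1) by lia, show a - (i + 1) + 1 = a - i by lia]
  refine Set.mem_biUnion (x := a - k) (by simp only [Set.mem_Iic]; lia) ⟨_, h _ le_rfl, ?_⟩
  simp only [show a - (a - k) = k by lia]

/-- Up to few exceptions, the stops on the way to `x` lie on a given geodesic. -/
theorem card_le_of_subset_stopSet {D r b M : ℕ} {β : ℕ → V} {A : Finset V} {Z : Set (V × V)}
    (hK : K.Connected) (hD : K.IsThin D)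
    (hM : ∀ u v, K.Adj u v → ∃ S : Finset V, S.card ≤ M ∧ K.arcVertices (8 * D + 4) u v ⊆ S)
    (hβ : K.IsGeodesicPath β b) (hr : ∀ d ∈ Z, K.dist d.1 (β b) ≤ r)
    (hT : ∀ (α : ℕ → V) (a k : ℕ), K.IsGeodesicPath α a → α 0 = β 0 → (α a, α (a + 1)) ∈ Z →
      0 < k → k ≤ a → a ≤ k + (r + D + 1) → α k ∉ β '' Set.Iic b → T (α k) (α (k + 1)) (α (k - 1)))
    (hA : ∀ v ∈ A, ∃ d ∈ Z, v ∈ K.stopSet T (r + D + 1) d.1 d.2 (β 0)) :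
    A.card ≤ (2 * r + 3 * D + 3) * (M + 1) := by
  classical
  -- The ends differ by `r`, the traveller makes `r + D + 1` steps, and the edge of `β` found near
  -- the stop may lie `2 * D + 1` further back.
  obtain ⟨J, hJ⟩ : ∃ J, J = 2 * r + 3 * D + 2 := ⟨_, rfl⟩
  have hM' : ∀ j, ∃ S : Finset V, S.card ≤ M ∧
      (j < b → K.arcVertices (8 * D + 4) (β j) (β (j + 1)) ⊆ S) := by
    intro j
    by_cases hj : j < b
    · obtain ⟨S, h1, h2⟩ := hM _ _ (hβ.adj hj)
      exact ⟨S, h1, fun _ => h2⟩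
    · exact ⟨∅, by simp, fun h => absurd h hj⟩
  choose S hSM hS using hM'
  have hsub : A ⊆ (Finset.Icc (b - J) b).image β ∪ (Finset.Ico (b - J) b).biUnion S := by
    intro v hv
    obtain ⟨⟨o, w⟩, hZ, α, a, k, hα, h0, rfl, rfl, hka, hkN, hk, -, rfl⟩ := hA v hv
    have hrd := hr _ hZ
    have hba : b ≤ a + r := by
      have h1 := hα.dist_eq (Nat.zero_le a) le_rfl
      have h2 := hβ.dist_eq (Nat.zero_le b) le_rfl
      have h3 := hK.dist_triangle (u := β 0) (v := α a) (w := β b)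
      rw [h0] at h1
      simp only at hrd
      lia
    rw [Finset.mem_union]
    by_cases hkβ : α k ∈ β '' Set.Iic b
    · left
      obtain ⟨t, ht, hkt⟩ := hkβ
      rw [Set.mem_Iic] at ht
      refine Finset.mem_image.2 ⟨t, Finset.mem_Icc.2 ⟨?_, ht⟩, hkt⟩
      have h1 := hα.dist_eq (Nat.zero_le k) hka
      have h2 := hβ.dist_eq (Nat.zero_le t) ht
      rw [h0, ← hkt] at h1
      lia
    · right
      have hk0 : 0 < k := by
        rcases Nat.eq_zero_or_pos k with rfl | h
        · exact absurd ⟨0, Nat.zero_le b, h0.symm⟩ hkβ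
        · exact h
      have hkT := hT α a k hα h0 hZ hk0 hka hkN hkβ
      -- Off `β` neither `x` nor a forbidden turn can cause the stop, so all steps have been made.
      -- This is just far enough from the end of `α` for `exists_mem_arcVertices`.
      have haN : a = k + (r + D + 1) := by
        rcases hk with h | h | h
        exacts [absurd h hk0.ne', h, absurd hkT h]
      obtain ⟨j, hjb, hkj, hj⟩ := hα.exists_mem_arcVertices hK hD hβ h0 hrd (by lia) hkβ
      refine Finset.mem_biUnion.2 ⟨j, Finset.mem_Ico.2 ⟨by lia, hjb⟩, ?_⟩
      exact hS j hjb hj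
  calc A.card ≤ ((Finset.Icc (b - J) b).image β).card + ((Finset.Ico (b - J) b).biUnion S).card :=
        (Finset.card_le_card hsub).trans (Finset.card_union_le _ _)
    _ ≤ (Finset.Icc (b - J) b).card + (Finset.Ico (b - J) b).card * M :=
        add_le_add Finset.card_image_le (Finset.card_biUnion_le_card_mul _ _ _ fun j _ => hSM j)
    _ ≤ (J + 1) + (J + 1) * M := by
        rw [Nat.card_Icc, Nat.card_Ico]
        exact add_le_add (by lia) (Nat.mul_le_mul_right _ (by lia))
    _ = (2 * r + 3 * D + 3) * (M + 1) := by rw [hJ]; ring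

end StopSet

/-! ### Equivariance and allowed turns. -/

section Action

variable {Γ : Type*} [Group Γ] {V : Type u} [MulAction Γ V] {K : SimpleGraph V}

theorem JoinedIn.smul (hΓ : ∀ (g : Γ) (v w : V), K.Adj v w → K.Adj (g • v) (g • w)) (g : Γ)
    {L : ℕ} {u v w : V} (h : K.JoinedIn (· ≠ v) L u w) :
    K.JoinedIn (· ≠ g • v) L (g • u) (g • w) := by
  obtain ⟨p, h1, h2⟩ := h
  let f : K →g K := ⟨(g • ·), hΓ g _ _⟩
  refine ⟨p.map f, by rwa [Walk.length_map], fun z hz => ?_⟩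
  rw [Walk.support_map, List.mem_map] at hz
  obtain ⟨y, hy, rfl⟩ := hz
  exact fun h => h2 y hy (smul_left_cancel g h)

theorem SmallTurn.smul (hΓ : ∀ (g : Γ) (v w : V), K.Adj v w → K.Adj (g • v) (g • w)) (g : Γ)
    {L : ℕ} {v w w' : V} (h : K.SmallTurn L v w w') : K.SmallTurn L (g • v) (g • w) (g • w') :=
  ⟨hΓ g _ _ h.1, hΓ g _ _ h.2.1, h.2.2.smul hΓ g⟩

theorem smul_mem_arcVertices (hΓ : ∀ (g : Γ) (v w : V), K.Adj v w → K.Adj (g • v) (g • w)) (g : Γ)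
    {L : ℕ} {a b y : V} (h : y ∈ K.arcVertices L a b) :
    g • y ∈ K.arcVertices L (g • a) (g • b) := by
  obtain ⟨p, h1, h2, h3⟩ := h
  let f : K →g K := ⟨(g • ·), hΓ g _ _⟩
  refine ⟨p.map f, ?_, by rwa [Walk.length_map], ?_⟩
  · exact h1.map (f := f) (MulAction.injective g)
  · rw [Walk.support_map]
    exact List.mem_map_of_mem h3

theorem arcVertices_comm (L : ℕ) (a b : V) : K.arcVertices L a b ⊆ K.arcVertices L b a :=
  fun _ ⟨p, h1, h2, h3⟩ => ⟨p.reverse, h1.reverse, by simpa using h2, by simpa using h3⟩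

theorem dist_smul (hK : K.Connected)
    (hΓ : ∀ (g : Γ) (v w : V), K.Adj v w → K.Adj (g • v) (g • w)) (g : Γ) (v w : V) :
    K.dist (g • v) (g • w) = K.dist v w := by
  have hle : ∀ (g : Γ) (v w : V), K.dist (g • v) (g • w) ≤ K.dist v w := fun g v w => by
    obtain ⟨p, hp⟩ := hK.exists_walk_length_eq_dist v w
    let f : K →g K := ⟨(g • ·), hΓ g _ _⟩
    rw [← hp, ← Walk.length_map f p]
    exact dist_le (p.map f)
  refine (hle g v w).antisymm ?_
  simpa using hle g⁻¹ (g • v) (g • w)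

theorem smul_mem_stopSet (hK : K.Connected)
    (hΓ : ∀ (g : Γ) (v w : V), K.Adj v w → K.Adj (g • v) (g • w)) {T : V → V → V → Prop}
    (hT : ∀ (g : Γ) (v w w' : V), T v w w' → T (g • v) (g • w) (g • w')) (g : Γ) {N : ℕ}
    {o w x v : V} (h : v ∈ K.stopSet T N o w x) :
    g • v ∈ K.stopSet T N (g • o) (g • w) (g • x) := by
  obtain ⟨α, a, k, hα, h0, ha, ha', hka, hkN, hk, hkT, rfl⟩ := h
  refine ⟨fun i => g • α i, a, k, fun i hi j hj => ?_, congrArg (g • ·) h0,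
    congrArg (g • ·) ha, congrArg (g • ·) ha', hka, hkN, hk.imp_right (Or.imp_right (mt fun h => ?_)), fun j hj hja => hT g _ _ _ (hkT j hj hja), rfl⟩
  · rw [dist_smul hK hΓ]
    exact hα i hi j hj
  · simpa using hT g⁻¹ _ _ _ h

/-- If there are finitely many orbits of edges in a fine graph, then the finiteness is uniform. -/
theorem IsFineGraph.exists_card_arcVertices_le (hfine : K.IsFineGraph)
    (hΓ : ∀ (g : Γ) (v w : V), K.Adj v w → K.Adj (g • v) (g • w))
    (horb : {O : Set (Sym2 V) | ∃ e ∈ K.edgeSet,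
      O = Set.range (fun g : Γ => Sym2.map (fun v : V => g • v) e)}.Finite) (L : ℕ) :
    ∃ M : ℕ, ∀ a b, K.Adj a b → ∃ S : Finset V, S.card ≤ M ∧ K.arcVertices L a b ⊆ S := by
  classical
  have key : ∀ O : Set (Sym2 V), ∃ M : ℕ, O ∈ {O : Set (Sym2 V) | ∃ e ∈ K.edgeSet,
      O = Set.range (fun g : Γ => Sym2.map (fun v : V => g • v) e)} →
      ∀ a b, s(a, b) ∈ O → ∃ S : Finset V, S.card ≤ M ∧ K.arcVertices L a b ⊆ S := by
    intro O
    by_cases hO : ∃ e ∈ K.edgeSet, O = Set.range (fun g : Γ => Sym2.map (fun v : V => g • v) e)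
    · obtain ⟨e, he, rfl⟩ := hO
      induction e with | _ c d
      have hfin := hfine.finite_arcVertices he L
      have hS : ∀ g : Γ, ∃ S : Finset V, S.card ≤ hfin.toFinset.card ∧
          K.arcVertices L (g • c) (g • d) ⊆ S := fun g =>
        ⟨hfin.toFinset.image (g • ·), Finset.card_image_le, fun y hy => by
          have := smul_mem_arcVertices hΓ g⁻¹ hy
          rw [inv_smul_smul, inv_smul_smul] at this
          exact Finset.mem_coe.2 (Finset.mem_image.2 ⟨_, hfin.mem_toFinset.2 this,
            smul_inv_smul _ _⟩)⟩
      refine ⟨hfin.toFinset.card, fun _ a b => ?_⟩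
      rintro ⟨g, hg⟩
      obtain ⟨S, h1, h2⟩ := hS g
      simp only [Sym2.map_mk, Sym2.eq_iff] at hg
      rcases hg with ⟨rfl, rfl⟩ | ⟨rfl, rfl⟩
      · exact ⟨S, h1, h2⟩
      · exact ⟨S, h1, (arcVertices_comm L _ _).trans h2⟩
    · exact ⟨0, fun h => absurd h hO⟩
  choose M hM using key
  refine ⟨horb.toFinset.sup M, fun a b hab => ?_⟩
  have hmem : Set.range (fun g : Γ => Sym2.map (fun v : V => g • v) s(a, b)) ∈ horb.toFinset :=
    horb.mem_toFinset.2 ⟨_, hab, rfl⟩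
  obtain ⟨S, h1, h2⟩ := hM _ (horb.mem_toFinset.1 hmem) a b ⟨1, by simp⟩
  exact ⟨S, h1.trans (Finset.le_sup hmem), h2⟩

variable (Γ) in
/-- The turns that are allowed for a given finite set `Φ` of oriented edges: the small turns, and
those which are, up to small turns, translates of turns between edges in `Φ`. -/
def AllowedTurn (K : SimpleGraph V) (Φ : Set (V × V)) (L : ℕ) (v w w' : V) : Prop :=
  K.SmallTurn L v w w' ∨ ∃ (t : Γ) (u u' : V), (v, u) ∈ (t • ·) '' Φ ∧ (v, u') ∈ (t • ·) '' Φ ∧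
    K.SmallTurn L v w u ∧ K.SmallTurn L v u' w'

theorem AllowedTurn.smul (hΓ : ∀ (g : Γ) (v w : V), K.Adj v w → K.Adj (g • v) (g • w))
    {Φ : Set (V × V)} {L : ℕ} (g : Γ) (v w w' : V) (h : K.AllowedTurn Γ Φ L v w w') :
    K.AllowedTurn Γ Φ L (g • v) (g • w) (g • w') := by
  refine h.imp (fun h => h.smul hΓ g) ?_
  rintro ⟨t, u, u', ⟨d, hd, hu⟩, ⟨d', hd', hu'⟩, h1, h2⟩
  refine ⟨g * t, g • u, g • u', ⟨d, hd, ?_⟩, ⟨d', hd', ?_⟩, h1.smul hΓ g, h2.smul hΓ g⟩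
  · simp only [mul_smul] at hu ⊢
    rw [hu]; rfl
  · simp only [mul_smul] at hu' ⊢
    rw [hu']; rfl

theorem finite_allowedTurn (hfine : K.IsFineGraph)
    (hst : ∀ e ∈ K.edgeSet, {g : Γ | Sym2.map (fun v : V => g • v) e = e}.Finite)
    {Φ : Set (V × V)} (hΦ : Φ.Finite) (hΦK : ∀ d ∈ Φ, K.Adj d.1 d.2) (L : ℕ) (v w : V) :
    {w' | K.AllowedTurn Γ Φ L v w w'}.Finite := by
  -- These `t` lie in one coset of the finite stabilizer of the edge underlying `d`.
  have htrans : ∀ d ∈ Φ, ∀ c : V × V, {t : Γ | t • d = c}.Finite := by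
    intro d hd c
    rcases Set.eq_empty_or_nonempty {t : Γ | t • d = c} with h | ⟨t₀, ht₀⟩
    · rw [h]; exact Set.finite_empty
    refine ((hst s(d.1, d.2) (hΦK d hd)).image (t₀ * ·)).subset fun t ht => ?_
    refine ⟨t₀⁻¹ * t, ?_, mul_inv_cancel_left _ _⟩
    have h1 : (t₀⁻¹ * t) • d = d := by
      rw [mul_smul, show t • d = c from ht, inv_smul_eq_iff]
      exact (show t₀ • d = c from ht₀).symm
    have h2 := congrArg Prod.fst h1
    have h3 := congrArg Prod.snd h1
    rw [Prod.smul_fst] at h2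
    rw [Prod.smul_snd] at h3
    rw [Set.mem_ofPred_eq, Sym2.map_mk, h2, h3]
  refine ((hfine.finite_smallTurn L v w).union
    ((hfine.finite_smallTurn L v w).biUnion fun u _ =>
      (hΦ.biUnion fun d hd => htrans d hd (v, u)).biUnion fun t _ =>
        ((hΦ.image (t • ·)).image Prod.snd).biUnion fun u' _ =>
          hfine.finite_smallTurn L v u')).subset ?_
  rintro w' (h | ⟨t, u, u', ⟨d, hd, hu⟩, hu', h1, h2⟩)
  · exact Or.inl h
  · right
    simp only [Set.mem_iUnion]
    exact ⟨u, h1, t, ⟨d, hd, hu⟩, u', ⟨_, hu', rfl⟩, h2⟩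

/-- A geodesic from `x` to a vertex joined by a walk with edges in `Φ` to the end of a second
geodesic makes allowed turns near its end, outside of the second geodesic. -/
theorem IsGeodesicPath.allowedTurn {D r N L a b k : ℕ} {α β : ℕ → V} {Φ : Set (V × V)}
    (hK : K.Connected) (hD : K.IsThin D) (hα : K.IsGeodesicPath α a) (hβ : K.IsGeodesicPath β b)
    (h0 : α 0 = β 0) (hr : K.dist (α a) (β b) ≤ r) (hadj : K.Adj (α a) (α (a + 1)))
    (haΦ : (α a, α (a + 1)) ∈ Φ) (γ : K.Walk (β b) (α a))
    (hγ : ∀ u u', s(u, u') ∈ γ.edges → (u, u') ∈ Φ)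
    (hL : N + 3 * r + 3 * D + 2 + γ.length + N ≤ L) (hk0 : 0 < k) (hka : k ≤ a) (hkN : a ≤ k + N)
    (hkβ : α k ∉ β '' Set.Iic b) : K.AllowedTurn Γ Φ L (α k) (α (k + 1)) (α (k - 1)) := by
  have hj := hα.joinedIn_avoiding hK hD hβ h0 hr hk0 hka hkN hkβ
  have hbk : β b ≠ α k := fun h => hkβ ⟨b, le_refl b, h⟩
  have hadj1 : K.Adj (α k) (α (k - 1)) := by
    have := (hα.adj (i := k - 1) (by lia)).symm
    rwa [Nat.sub_add_cancel hk0] at this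
  have hadj2 : K.Adj (α k) (α (k + 1)) := by
    rcases hka.eq_or_lt with rfl | h
    exacts [hadj, hα.adj h]
  have hend : k < a → K.JoinedIn (· ≠ α k) N (α a) (α (k + 1)) := fun h => by
    refine ((hα.joinedIn (i := k + 1) h le_rfl).mono (by lia) ?_).symm
    rintro z ⟨t, ht, hta, rfl⟩ h
    have := hα.injOn hta hka h
    lia
  -- If `γ` passes through `α k`, its first edges into `α k` from either end give the turn in `Φ`;
  -- for `k = a` the edge to `α (a + 1)` replaces one of them. Otherwise `γ` itself joins the two
  -- sides while avoiding `α k`, and the turn is small.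
  by_cases hkγ : α k ∈ γ.support
  · right
    obtain ⟨u', hu', hu'γ⟩ := γ.exists_joinedIn_of_mem_support hkγ hbk
    have hΦ' : (α k, u') ∈ Φ := hγ _ _ (by rwa [Sym2.eq_swap])
    have h2 : K.SmallTurn L (α k) u' (α (k - 1)) :=
      ⟨(γ.adj_of_mem_edges hu'γ).symm, hadj1, ((hj.trans hu').symm).mono (by lia) fun z hz => hz⟩
    have h1 : ∃ u, (α k, u) ∈ Φ ∧ K.SmallTurn L (α k) (α (k + 1)) u := by
      rcases hka.eq_or_lt with rfl | h
      · exact ⟨_, haΦ, hadj2, hadj2,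
          JoinedIn.refl (P := (· ≠ α k)) hadj2.ne'⟩
      · have hak : α a ≠ α k := fun h' => by
          have := hα.injOn le_rfl hka h'
          lia
        obtain ⟨u, hu, huγ⟩ := γ.reverse.exists_joinedIn_of_mem_support (by simpa using hkγ) hak
        rw [Walk.edges_reverse, List.mem_reverse] at huγ
        rw [Walk.length_reverse] at hu
        exact ⟨u, hγ _ _ (by rwa [Sym2.eq_swap]), hadj2, (γ.adj_of_mem_edges huγ).symm,
          ((hend h).symm.trans hu).mono (by lia) fun z hz => hz⟩
    obtain ⟨u, hu, h1⟩ := h1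
    exact ⟨1, u, u', ⟨_, hu, one_smul _ _⟩, ⟨_, hΦ', one_smul _ _⟩, h1, h2⟩
  · left
    have hka' : k < a := hka.lt_of_ne fun h => hkγ (h ▸ γ.end_mem_support)
    have hjγ : K.JoinedIn (· ≠ α k) γ.length (β b) (α a) :=
      ⟨γ, le_rfl, fun z hz h => hkγ (h ▸ hz)⟩
    exact ⟨hadj2, hadj1, ((hj.trans hjγ).trans (hend hka')).symm.mono (by lia) fun z hz => hz⟩

end Action

end SimpleGraph

/-! ### Measures on the vertices, and the conclusion. -/

theorem HasReiterMaps.of_unique (G X Y : Type*) [Group G] [MulAction G X] [MulAction G Y]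
    [Unique Y] : HasReiterMaps G X Y := by
  intro E ε hε
  refine ⟨{default}, fun _ _ => 1, fun _ _ => zero_le_one, fun x t ht => ?_, fun x => by simp,
    fun s _ x W => by simpa using hε.le⟩
  exact absurd (Finset.mem_singleton.2 (Unique.eq_default t)) ht

namespace SimpleGraph

open scoped Pointwise

/-- A group acting on a fine hyperbolic graph with finitely many orbits of edges and with finite
edge stabilizers has approximately equivariant maps from the vertices to measures on the
vertices. -/
theorem IsHyperbolicGraph.hasReiterMaps {Γ V : Type u} [Group Γ] [MulAction Γ V]
    {K : SimpleGraph V} (hK : K.IsHyperbolicGraph) (hfine : K.IsFineGraph)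
    (hΓ : ∀ (g : Γ) (v w : V), K.Adj v w → K.Adj (g • v) (g • w))
    (horb : {O : Set (Sym2 V) | ∃ e ∈ K.edgeSet,
      O = Set.range (fun g : Γ => Sym2.map (fun v : V => g • v) e)}.Finite)
    (hst : ∀ e ∈ K.edgeSet, {g : Γ | Sym2.map (fun v : V => g • v) e = e}.Finite) :
    HasReiterMaps Γ V V := by
  classical
  have hc : K.Connected := hK.1
  by_cases hedge : ∃ o w, K.Adj o w
  swap
  · have : Subsingleton V := by
      by_contra hV
      rw [not_subsingleton_iff_nontrivial] at hV
      obtain ⟨o⟩ := hc.nonempty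
      exact hedge ⟨o, hc.preconnected.exists_adj_of_nontrivial o⟩
    obtain ⟨v⟩ := hc.nonempty
    have : Unique V := ⟨⟨v⟩, fun x => Subsingleton.elim x v⟩
    exact .of_unique Γ V V
  obtain ⟨o, w, how⟩ := hedge
  obtain ⟨D, hD⟩ := hK.exists_isThin
  obtain ⟨M, hM⟩ := hfine.exists_card_arcVertices_le hΓ horb (8 * D + 4)
  let γ : ∀ g : Γ, K.Walk o (g • o) := fun g => (hc.preconnected o (g • o)).some
  refine HasReiterMaps.of_growth fun E => ?_
  let S : Finset Γ := insert 1 (E ∪ E⁻¹)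
  have h1S : (1 : Γ) ∈ S := Finset.mem_insert_self _ _
  let R : ℕ := S.sup fun s => K.dist o (s • o)
  have hR : ∀ k, ∀ g ∈ S ^ k, K.dist o (g • o) ≤ k * R := by
    intro k
    induction k with
    | zero =>
      intro g hg
      rw [pow_zero, Finset.mem_one] at hg
      simp [hg]
    | succ k ih =>
      intro g hg
      rw [pow_succ'] at hg
      obtain ⟨s, hs, h, hh, rfl⟩ := Finset.mem_mul.1 hg
      have h1 := hc.dist_triangle (u := o) (v := s • o) (w := (s * h) • o)
      rw [mul_smul, dist_smul hc hΓ] at h1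
      have h2 : K.dist o (s • o) ≤ R := Finset.le_sup (f := fun s => K.dist o (s • o)) hs
      have h3 := ih h hh
      rw [mul_smul]
      lia
  -- `R`, `D` and `M` do not depend on `n`, whereas `Φ`, the allowed turns and the finite supports
  -- below may. The displacement bound `r` is linear in `n`.
  refine ⟨(2 * R + 3 * D + 3) * (M + 1), fun n => ?_⟩
  obtain ⟨r, hr⟩ : ∃ r, r = (n + 1) * R := ⟨_, rfl⟩
  let Φ : Set (V × V) := (⋃ g ∈ S ^ (n + 1), {d | s(d.1, d.2) ∈ (γ g).edges}) ∪
    ⋃ g ∈ S ^ (n + 1), {(g • o, g • w)}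
  have hΦ : Φ.Finite := by
    refine ((S ^ (n + 1)).finite_toSet.biUnion fun g _ => ?_).union
      ((S ^ (n + 1)).finite_toSet.biUnion fun g _ => Set.finite_singleton _)
    refine ((γ g).support.finite_toSet.prod (γ g).support.finite_toSet).subset fun d hd => ?_
    exact ⟨(γ g).fst_mem_support_of_mem_edges hd, (γ g).snd_mem_support_of_mem_edges hd⟩
  have hΦK : ∀ d ∈ Φ, K.Adj d.1 d.2 := by
    rintro d (hd | hd)
    · obtain ⟨g, -, hd⟩ := Set.mem_iUnion₂.1 hd
      exact (γ g).adj_of_mem_edges hd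
    · obtain ⟨g, -, rfl⟩ := Set.mem_iUnion₂.1 hd
      exact hΓ g o w how
  let ℓ : ℕ := (S ^ (n + 1)).sup fun g => (γ g).length
  let T : V → V → V → Prop :=
    K.AllowedTurn Γ Φ ((r + D + 1) + 3 * r + 3 * D + 2 + ℓ + (r + D + 1))
  have hTfin : ∀ v w, {w' | T v w w'}.Finite := finite_allowedTurn hfine hst hΦ hΦK _
  have hTsmul : ∀ (g : Γ) (v w w' : V), T v w w' → T (g • v) (g • w) (g • w') :=
    AllowedTurn.smul hΓ
  choose F hF hFsub using fun g : Γ =>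
    exists_finite_stopSet_subset K hTfin (r + D + 1) (g • o) (g • w)
  let A : ℕ → V → Finset V := fun k x =>
    (S ^ k).biUnion fun g => ((hF g).subset (hFsub g x)).toFinset
  have hA : ∀ {k x v}, v ∈ A k x ↔
      ∃ g ∈ S ^ k, v ∈ K.stopSet T (r + D + 1) (g • o) (g • w) x := by
    intro k x v
    simp only [A, Finset.mem_biUnion, Set.Finite.mem_toFinset]
  have hpow : ∀ {k}, k ≤ n + 1 → S ^ k ⊆ S ^ (n + 1) := fun hk =>
    Finset.pow_subset_pow_right h1S hk
  refine ⟨(S ^ (n + 1)).biUnion fun g => (hF g).toFinset, A, fun k x => ?_, fun k hk x v hv => ?_,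
    fun k hk x => ?_, fun k x v hv => ?_, fun s hs k x v hv => ?_, fun s hs k x v hv => ?_⟩
  · obtain ⟨v, hv⟩ := hc.nonempty_stopSet T (r + D + 1) ((1 : Γ) • o) ((1 : Γ) • w) x
    exact ⟨v, hA.2 ⟨1, Finset.one_mem_pow h1S, hv⟩⟩
  · obtain ⟨g, hg, hv⟩ := hA.1 hv
    exact Finset.mem_biUnion.2 ⟨g, hpow hk hg, (hF g).mem_toFinset.2 (hFsub g x hv)⟩
  · obtain ⟨β, b, hβ, rfl, rfl⟩ := hc.exists_isGeodesicPath x o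
    refine (card_le_of_subset_stopSet (r := r) (T := T)
      (Z := (fun g : Γ => (g • β b, g • w)) '' (S ^ (n + 1) : Finset Γ)) hc hD hM hβ ?_ ?_ ?_).trans ?_
    · rintro _ ⟨g, hg, rfl⟩
      rw [dist_comm, hr]
      exact hR _ g hg
    · intro α a k hα h0 hZ hk0 hka hkN hkβ
      obtain ⟨g, hg, hgα⟩ := hZ
      obtain ⟨ha, ha'⟩ := Prod.mk.inj hgα
      refine hα.allowedTurn (r := r) (N := r + D + 1) hc hD hβ h0 ?_ ?_ ?_ ((γ g).copy rfl ha)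
        ?_ ?_ hk0 hka hkN hkβ
      · rw [← ha, dist_comm, hr]
        exact hR _ g hg
      · rw [← ha, ← ha']
        exact hΓ g _ _ how
      · rw [← ha, ← ha']
        exact Or.inr (Set.mem_biUnion (Finset.mem_coe.1 hg) rfl)
      · intro u u' hu
        rw [Walk.edges_copy] at hu
        exact Or.inl (Set.mem_biUnion (Finset.mem_coe.1 hg) hu)
      · rw [Walk.length_copy]
        have : (γ g).length ≤ ℓ := Finset.le_sup (f := fun g => (γ g).length) (Finset.mem_coe.1 hg)
        lia
    · intro v hv
      obtain ⟨g, hg, hv⟩ := hA.1 hv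
      exact ⟨_, ⟨g, hpow hk hg, rfl⟩, hv⟩
    · rw [hr, mul_right_comm]
      refine Nat.mul_le_mul_right _ ?_
      nlinarith [Nat.zero_le (D * n)]
  · obtain ⟨g, hg, hv⟩ := hA.1 hv
    exact hA.2 ⟨g, Finset.pow_subset_pow_right h1S (Nat.le_succ k) hg, hv⟩
  · obtain ⟨y, hy, rfl⟩ := Finset.mem_image.1 hv
    obtain ⟨g, hg, hy⟩ := hA.1 hy
    have := smul_mem_stopSet hc hΓ hTsmul s hy
    rw [← mul_smul, ← mul_smul] at this
    refine hA.2 ⟨s * g, ?_, this⟩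
    rw [pow_succ']
    exact Finset.mul_mem_mul
      (Finset.mem_insert_of_mem (Finset.mem_union_left _ hs)) hg
  · obtain ⟨g, hg, hv⟩ := hA.1 hv
    have := smul_mem_stopSet hc hΓ hTsmul s⁻¹ hv
    rw [← mul_smul, ← mul_smul, inv_smul_smul] at this
    refine Finset.mem_image.2 ⟨s⁻¹ • v, hA.2 ⟨s⁻¹ * g, ?_, this⟩, smul_inv_smul _ _⟩
    rw [pow_succ']
    exact Finset.mul_mem_mul (Finset.mem_insert_of_mem
      (Finset.mem_union_right _ (Finset.inv_mem_inv hs))) hg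

end SimpleGraph

theorem mainTheorem3 (Γ : Type u) [Group Γ] [Group.FG Γ] (𝒢 : Set (Subgroup Γ))
    (hΓ : IsHyperbolicRelativeTo Γ 𝒢) (hexact : ∀ H ∈ 𝒢, IsExactGroup H) :
    IsExactGroup Γ := by
  obtain ⟨V, _, K, hadj, hK, hfine, horb, hst, hinf⟩ := hΓ
  refine HasReiterMaps.isExactGroup (HasReiterMaps.of_stabilizers (V := V) ?_ fun v => ?_)
  · obtain ⟨v⟩ := hK.1.nonempty
    exact (hK.hasReiterMaps hfine hadj horb hst).comap (fun g : Γ => g • v) fun g x => mul_smul g x v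
  -- Members of `𝒢` enter only through infinite stabilizers, which are their conjugates and hence
  -- isomorphic to them.
  · rcases finite_or_infinite (MulAction.stabilizer Γ v) with h | h
    · exact .of_finite _
    · obtain ⟨H, hH, g, hg⟩ := (hinf _ h).1 ⟨v, rfl⟩
      rw [← hg]
      exact (hexact H hH).hasReiterMaps.of_mulEquiv
        (H.equivMapOfInjective _ (MulAut.conj g).injective)
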